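/- **Setting.** Let $V$ be a monoidal category (product $\otimes$, unit $1$, not assumed symmetric) whose sets of arrows $V(p;r)$ carry a preorder; write $f\sim g$ ("equal up to the unique canonical isomorphism") when $f\le g$ and $g\le f$. Composition is monotone and $\otimes$ respects $\sim$. Suppose that $V$ has all small products, ordered by their projections ($f\le g$ as soon as $\pi_jf\le\pi_jg$ for all $j$); that every $-\otimes s$ has a right adjoint $(-)^s$ whose name bijection $V(r\otimes s;t)\cong V(r;t^s)$ respects $\sim$; and that for every parallel pair $f,g:p\to r$ there is an inverse image of $\sim$, i.e. a monic and order-reflecting arrow $\iota$ to $p$ through which exactly the arrows $h$ with $fh\sim gh$ factor. Let $V$ have a *relator's involution*: a family $m:(p\otimes s)\otimes(r\otimes t)\to(p\otimes r)\otimes(s\otimes t)$ which, up to $\sim$, is natural in $p,s,r,t$, self-inverse, and coherent with associativity and unit of $\otimes$ (compatible with the associators; equal to the canonical isomorphism when $p=s=1$ or $r=t=1$; the identity when $s=r=1$). It yields exchanges $c:r\otimes s\to s\otimes r$ by inserting units ($p=t=1$). A *$V$-graph* has objects, hom-objects $X(x;y)\in V$, chosen unit arrows $1\to X(x;x)$ and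 composition (contact) arrows $X(x;y)\otimes X(y;z)\to X(x;z)$; it is a *lax $V$-category* if the unit and associativity laws hold up to $\sim$. A *transport* is a map of objects with arrows $X(x;y)\to Y(fx;fy)$; it is *original* if it preserves units up to $\sim$, and a *laxly natural functor* if it also preserves composition up to $\sim$. Lax $V$-categories and laxly natural functors form the category $\mathrm{Catl}_V$. Transports with the same object map are compared (by $\le$, $\sim$) on hom-objects; transports $g,g'$ into a space of transforms are compared by the secondary relations $\le_2,\sim_2$: the transports $g(a),g'(a)$ and all components of the hom-arrows are so related. Let $T$ be a small lax $V$-category. - $X\otimes T$ has objects $(x,s)$, hom-objects $X(x;y)\otimes T(s;t)$ and composition defined by $m$. - $Y^T$ has as objects all transports $\varphi:T\to Y$ and hom-objects $\prod_sY(\varphi s;\psi s)$. For $f:X\to Y$ let $f^T:X^T\to Y^T$ be postcomposition. - The *precontact* (resp. *postcontact*) arrow $\big(\prod_sY(\varphi s;\psi s)\big)\otimes T(s;s')\to Y(\varphi s;\psi s')$ composes the $s$-component with $\psi_{s,s'}$ (resp. applies the exchange $c$ and composes $\varphi_{s,s'}$ with the $s'$-component). They are the hom-arrows of the pre- and postevaluation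 transports $Y^T\otimes T\to Y$, $(\varphi,s)\mapsto\varphi s$. - $Y^{(T)}$ has as objects the laxly natural functors $T\to Y$; its hom-objects of laxly natural transforms $\iota:Y^{(T)}(\varphi;\psi)\to\prod_sY(\varphi s;\psi s)$ are the inverse images of $\sim$ for the families of names of pre- and postcontact arrows. Let $J:Y^{(T)}\to Y^T$ be this embedding and $ev^\pm_Y:Y^{(T)}\otimes T\to Y$ the restricted pre- /postevaluation. - The sections transport $X\to(X\otimes T)^T$ sends $a$ to $s\mapsto(a,s)$ with hom-arrows $1_a\otimes T(s;t)$, and $X(a;b)$ to the family $X(a;b)\otimes1_s$. The *name* of $f:X\otimes T\to Y$ is sections followed by $f^T$; the *pre- /postrealization* of $g:X\to Y^T$ is $g\otimes\mathrm{Id}_T$ followed by pre- /postevaluation. Put $f^\pm$ = pre- /postrealization of the name of $f$. **Statement.** In $\mathrm{Catl}_V$ (with objects in a universe large enough to be closed under $(-)^{(T)}$): 1. $X\mapsto X\otimes T$, $g\mapsto g\otimes\mathrm{Id}_T$ is an endofunctor; if $\otimes$ is monotone in $V$, then $g\le g'$ implies $g\otimes\mathrm{Id}_T\le g'\otimes\mathrm{Id}_T$.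 2. $Y\mapsto Y^{(T)}$ is an endofunctor, and for a laxly natural functor $f:X\to Y$ the transport $f^T$ restricts along $J$ to the laxly natural functor $f^{(T)}:X^{(T)}\to Y^{(T)}$; $f\le f'$ implies $f^{(T)}\le_2f'^{(T)}$. 3. The sections corestrict along $J$ to laxly natural functors $\lambda_X:X\to(X\otimes T)^{(T)}$. They are natural up to $\sim_2$; for arbitrary original transports $f$ of $V$-graphs, sections followed by $(f\otimes\mathrm{Id}_T)^T$ is $\sim_2$-equal to $f$ followed by sections, and equal to it if $f$ preserves units strictly. 4. $ev^+_Y$ and $ev^-_Y$ are laxly natural functors, $ev^+_Y\sim ev^-_Y$, and both are natural in $Y$, up to $\sim$, for laxly natural functors. 5. With unit $\lambda$ and either of the two counits $ev^+$, $ev^-$ both triangular equalities hold up to $\sim$ (resp. $\sim_2$). The name $X\to Y^{(T)}$ of a laxly natural $f:X\otimes T\to Y$ ($\lambda_X$ followed by $f^{(T)}$, which lies over the name of $f$ in $Y^T$) and the realizations $X\otimes T\to Y$ of $g:X\to Y^{(T)}$ ($g\otimes\mathrm{Id}_T$ followed by $ev^\pm_Y$) are mutually inverse up to $\sim$, $\sim_2$;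 they preserve and reflect $\sim$, $\sim_2$ and are natural in $X$ and $Y$ up to $\sim$, $\sim_2$. 6. For a laxly natural functor $f:X\otimes T\to Y$, the name of $f$ factors through $J$ by a laxly natural functor $X\to Y^{(T)}$ if and only if $f^+\sim f\sim f^-$. More generally, let $f:X\otimes T\to Y$ be any transport for which every transport $T\to Y$ appointed by its name is a laxly natural functor. Then its name factors through $J:Y^{(T)}\to Y^T$ if and only if $f^+\sim f^-$; and if moreover $f\le f^+$ and $f^-\le f$, it does so if and only if $f^+\sim f\sim f^-$. -/

import Mathlib

universe w w' w'' t v u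

open CategoryTheory MonoidalCategory Limits

noncomputable section

namespace VLax

/-- A monoidal category `V` whose sets of arrows `p ⟶ r` carry an order relation (a preorder, so
that mutual inequality does not force equality). Composition is monotone and the biproduct `⊗`
respects mutual inequality. -/
class OrderedMonoidal (V : Type u) [Category.{v} V] [MonoidalCategory V] where
  [homPreorder : ∀ p r : V, Preorder (p ⟶ r)]
  comp_mono : ∀ {p r s : V} {f f' : p ⟶ r} {g g' : r ⟶ s}, f ≤ f' → g ≤ g' → f ≫ g ≤ f' ≫ g'
  tensor_congr : ∀ {p p' r r' : V} {f f' : p ⟶ p'} {g g' : r ⟶ r'},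
    f ≤ f' → f' ≤ f → g ≤ g' → g' ≤ g → (f ⊗ₘ g) ≤ (f' ⊗ₘ g')

attribute [instance] OrderedMonoidal.homPreorder

section Values

variable {V : Type u} [Category.{v} V] [MonoidalCategory V] [OrderedMonoidal V]

/-- Equality of arrows up to the unique canonical isomorphism: two arrows of an ordered set of
arrows are isomorphic in it exactly when each is below the other. -/
def Sim {p r : V} (f g : p ⟶ r) : Prop := f ≤ g ∧ g ≤ f

infix:50 " ∼ " => Sim

theorem Sim.refl {p r : V} (f : p ⟶ r) : f ∼ f := ⟨le_rfl, le_rfl⟩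

theorem Sim.symm {p r : V} {f g : p ⟶ r} (h : f ∼ g) : g ∼ f := ⟨h.2, h.1⟩

theorem Sim.trans {p r : V} {f g k : p ⟶ r} (h : f ∼ g) (h' : g ∼ k) : f ∼ k :=
  ⟨h.1.trans h'.1, h'.2.trans h.2⟩

theorem Sim.comp {p r s : V} {f f' : p ⟶ r} {g g' : r ⟶ s} (hf : f ∼ f') (hg : g ∼ g') :
    f ≫ g ∼ f' ≫ g' :=
  ⟨OrderedMonoidal.comp_mono hf.1 hg.1, OrderedMonoidal.comp_mono hf.2 hg.2⟩

theorem Sim.tensor {p p' r r' : V} {f f' : p ⟶ p'} {g g' : r ⟶ r'} (hf : f ∼ f') (hg : g ∼ g') :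
    (f ⊗ₘ g) ∼ (f' ⊗ₘ g') :=
  ⟨OrderedMonoidal.tensor_congr hf.1 hf.2 hg.1 hg.2,
    OrderedMonoidal.tensor_congr hf.2 hf.1 hg.2 hg.1⟩

theorem Sim.whiskerRight {p p' : V} {f f' : p ⟶ p'} (hf : f ∼ f') (r : V) :
    f ▷ r ∼ f' ▷ r := by
  simpa only [tensorHom_id] using hf.tensor (Sim.refl (𝟙 r))

theorem Sim.whiskerLeft (r : V) {p p' : V} {f f' : p ⟶ p'} (hf : f ∼ f') :
    r ◁ f ∼ r ◁ f' := by
  simpa only [id_tensorHom] using (Sim.refl (𝟙 r)).tensor hf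

/-- Monotone biproduct in the values category. -/
def MonotoneBiproduct (V : Type u) [Category.{v} V] [MonoidalCategory V] [OrderedMonoidal V] :
    Prop :=
  ∀ {p p' r r' : V} {f f' : p ⟶ p'} {g g' : r ⟶ r'}, f ≤ f' → g ≤ g' → (f ⊗ₘ g) ≤ (f' ⊗ₘ g')

variable (V) in
/-- A relator's involution that is laxly natural: a self-inverse interchange of the two middle
factors. All conditions hold up to canonical isomorphism: naturality in the four arguments,
self-inverseness, and coherence with the associativity and the unit of `⊗`. -/
class RelatorInvolution where
  m : ∀ p s r t : V, (p ⊗ s) ⊗ (r ⊗ t) ⟶ (p ⊗ r) ⊗ (s ⊗ t)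
  natural : ∀ {p p' s s' r r' t t' : V} (f : p ⟶ p') (g : s ⟶ s') (h : r ⟶ r') (k : t ⟶ t'),
    ((f ⊗ₘ g) ⊗ₘ (h ⊗ₘ k)) ≫ m p' s' r' t' ∼ m p s r t ≫ ((f ⊗ₘ h) ⊗ₘ (g ⊗ₘ k))
  involutive : ∀ p s r t : V, m p s r t ≫ m p r s t ∼ 𝟙 _
  associativity : ∀ p s r t q k : V,
    m p s r t ▷ (q ⊗ k) ≫ m (p ⊗ r) (s ⊗ t) q k ≫ ((α_ p r q).hom ⊗ₘ (α_ s t k).hom) ∼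
      (α_ (p ⊗ s) (r ⊗ t) (q ⊗ k)).hom ≫ (p ⊗ s) ◁ m r t q k ≫ m p s (r ⊗ q) (t ⊗ k)
  left_unit : ∀ p s : V,
    (λ_ (𝟙_ V)).inv ▷ (p ⊗ s) ≫ m (𝟙_ V) (𝟙_ V) p s ≫ ((λ_ p).hom ⊗ₘ (λ_ s).hom) ∼
      (λ_ (p ⊗ s)).hom
  right_unit : ∀ p s : V,
    (p ⊗ s) ◁ (λ_ (𝟙_ V)).inv ≫ m p s (𝟙_ V) (𝟙_ V) ≫ ((ρ_ p).hom ⊗ₘ (ρ_ s).hom) ∼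
      (ρ_ (p ⊗ s)).hom
  middle_unit : ∀ p t : V, m p (𝟙_ V) (𝟙_ V) t ∼ 𝟙 _

/-- The exchange of two factors that a relator's involution provides. -/
def swap [RelatorInvolution V] (r s : V) : r ⊗ s ⟶ s ⊗ r :=
  ((λ_ r).inv ⊗ₘ (ρ_ s).inv) ≫ RelatorInvolution.m (𝟙_ V) r s (𝟙_ V) ≫
    ((λ_ s).hom ⊗ₘ (ρ_ r).hom)

/-! Auxiliary: the quotient of the values category by canonical isomorphism of arrows, in which
calculations up to canonical isomorphism become equations. -/

variable (V) in
/-- The objects of the quotient category. -/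
structure Bar where
  /-- the object of the values category -/
  as : V

instance simSetoid (p r : V) : Setoid (p ⟶ r) := ⟨Sim, Sim.refl, Sim.symm, Sim.trans⟩

instance : Category (Bar V) where
  Hom A B := Quotient (simSetoid A.as B.as)
  id A := Quotient.mk _ (𝟙 A.as)
  comp f g := Quotient.map₂ (fun f g => f ≫ g) (fun _ _ hf _ _ hg => Sim.comp hf hg) f g
  id_comp f := by induction f using Quotient.ind; exact congrArg (Quotient.mk _) (Category.id_comp _)
  comp_id f := by induction f using Quotient.ind; exact congrArg (Quotient.mk _) (Category.comp_id _)
  assoc f g h := by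
    induction f using Quotient.ind; induction g using Quotient.ind; induction h using Quotient.ind
    exact congrArg (Quotient.mk _) (Category.assoc _ _ _)

/-- The class of an arrow in the quotient category. -/
def q {A B : V} (f : A ⟶ B) : (Bar.mk A) ⟶ (Bar.mk B) := Quotient.mk (simSetoid A B) f

theorem q_surj {A B : Bar V} (f : A ⟶ B) : ∃ g : A.as ⟶ B.as, q g = f := Quotient.exists_rep f

theorem sim_iff {A B : V} {f g : A ⟶ B} : f ∼ g ↔ q f = q g :=
  ⟨fun h => Quotient.sound h, fun h => Quotient.exact h⟩

theorem q_comp {A B C : V} (f : A ⟶ B) (g : B ⟶ C) : q (f ≫ g) = q f ≫ q g := rfl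

theorem q_id (A : V) : q (𝟙 A) = 𝟙 (Bar.mk A) := rfl

/-- An isomorphism of the values category in the quotient category. -/
def qIso {A B : V} (e : A ≅ B) : Bar.mk A ≅ Bar.mk B where
  hom := q e.hom
  inv := q e.inv
  hom_inv_id := by rw [← q_comp, e.hom_inv_id, q_id]
  inv_hom_id := by rw [← q_comp, e.inv_hom_id, q_id]

instance : MonoidalCategoryStruct (Bar V) where
  tensorObj A B := ⟨A.as ⊗ B.as⟩
  whiskerLeft A _ _ f := Quotient.map (fun f => A.as ◁ f) (fun _ _ hf => Sim.whiskerLeft _ hf) f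
  whiskerRight f A := Quotient.map (fun f => f ▷ A.as) (fun _ _ hf => Sim.whiskerRight hf _) f
  tensorHom f g := Quotient.map₂ (fun f g => f ⊗ₘ g) (fun _ _ hf _ _ hg => Sim.tensor hf hg) f g
  tensorUnit := ⟨𝟙_ V⟩
  associator A B C := qIso (α_ A.as B.as C.as)
  leftUnitor A := qIso (λ_ A.as)
  rightUnitor A := qIso (ρ_ A.as)

instance : MonoidalCategory (Bar V) where
  tensorHom_def f g := by
    induction f using Quotient.ind; induction g using Quotient.ind
    exact congrArg q (MonoidalCategory.tensorHom_def _ _)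
  id_tensorHom_id A B := congrArg q (MonoidalCategory.id_tensorHom_id A.as B.as)
  tensorHom_comp_tensorHom f g h k := by
    induction f using Quotient.ind; induction g using Quotient.ind
    induction h using Quotient.ind; induction k using Quotient.ind
    exact congrArg q (MonoidalCategory.tensorHom_comp_tensorHom _ _ _ _)
  whiskerLeft_id A B := congrArg q (MonoidalCategory.whiskerLeft_id A.as B.as)
  id_whiskerRight A B := congrArg q (MonoidalCategory.id_whiskerRight A.as B.as)
  associator_naturality f g h := by
    induction f using Quotient.ind; induction g using Quotient.ind; induction h using Quotient.ind
    exact congrArg q (MonoidalCategory.associator_naturality _ _ _)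
  leftUnitor_naturality f := by
    induction f using Quotient.ind
    exact congrArg q (MonoidalCategory.leftUnitor_naturality _)
  rightUnitor_naturality f := by
    induction f using Quotient.ind
    exact congrArg q (MonoidalCategory.rightUnitor_naturality _)
  pentagon A B C D := congrArg q (MonoidalCategory.pentagon A.as B.as C.as D.as)
  triangle A B := congrArg q (MonoidalCategory.triangle A.as B.as)

theorem q_tensor {A B C D : V} (f : A ⟶ B) (g : C ⟶ D) : q (f ⊗ₘ g) = (q f ⊗ₘ q g) := rfl
theorem q_whiskerLeft (A : V) {B C : V} (f : B ⟶ C) : q (A ◁ f) = Bar.mk A ◁ q f := rfl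
theorem q_whiskerRight {B C : V} (f : B ⟶ C) (A : V) : q (f ▷ A) = q f ▷ Bar.mk A := rfl

end Values

end VLax
namespace VLax

section StrictRelator

variable {C : Type u} [Category.{v} C] [MonoidalCategory C]

/-- Auxiliary: the coherence conditions of a relator's involution as equations. -/
structure IsStrictRelator (m : ∀ p s r t : C, (p ⊗ s) ⊗ (r ⊗ t) ⟶ (p ⊗ r) ⊗ (s ⊗ t)) : Prop where
  natural : ∀ {p p' s s' r r' t t' : C} (f : p ⟶ p') (g : s ⟶ s') (h : r ⟶ r') (k : t ⟶ t'),
    ((f ⊗ₘ g) ⊗ₘ (h ⊗ₘ k)) ≫ m p' s' r' t' = m p s r t ≫ ((f ⊗ₘ h) ⊗ₘ (g ⊗ₘ k))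
  involutive : ∀ p s r t : C, m p s r t ≫ m p r s t = 𝟙 _
  associativity : ∀ p s r t q k : C,
    m p s r t ▷ (q ⊗ k) ≫ m (p ⊗ r) (s ⊗ t) q k ≫ ((α_ p r q).hom ⊗ₘ (α_ s t k).hom) =
      (α_ (p ⊗ s) (r ⊗ t) (q ⊗ k)).hom ≫ (p ⊗ s) ◁ m r t q k ≫ m p s (r ⊗ q) (t ⊗ k)
  left_unit : ∀ p s : C,
    (λ_ (𝟙_ C)).inv ▷ (p ⊗ s) ≫ m (𝟙_ C) (𝟙_ C) p s ≫ ((λ_ p).hom ⊗ₘ (λ_ s).hom) =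
      (λ_ (p ⊗ s)).hom
  right_unit : ∀ p s : C,
    (p ⊗ s) ◁ (λ_ (𝟙_ C)).inv ≫ m p s (𝟙_ C) (𝟙_ C) ≫ ((ρ_ p).hom ⊗ₘ (ρ_ s).hom) =
      (ρ_ (p ⊗ s)).hom
  middle_unit : ∀ p t : C, m p (𝟙_ C) (𝟙_ C) t = 𝟙 _

variable {m : ∀ p s r t : C, (p ⊗ s) ⊗ (r ⊗ t) ⟶ (p ⊗ r) ⊗ (s ⊗ t)}

namespace IsStrictRelator

/-- The exchange derived from an interchange. -/
def sw (m : ∀ p s r t : C, (p ⊗ s) ⊗ (r ⊗ t) ⟶ (p ⊗ r) ⊗ (s ⊗ t)) (r s : C) : r ⊗ s ⟶ s ⊗ r :=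
  ((λ_ r).inv ⊗ₘ (ρ_ s).inv) ≫ m (𝟙_ C) r s (𝟙_ C) ≫ ((λ_ s).hom ⊗ₘ (ρ_ r).hom)

theorem conj (hm : IsStrictRelator m) {p p' s s' r r' t t' : C} (f : p ≅ p') (g : s ≅ s') (h : r ≅ r') (k : t ≅ t') :
    m p' s' r' t' = ((f.inv ⊗ₘ g.inv) ⊗ₘ (h.inv ⊗ₘ k.inv)) ≫ m p s r t ≫
      ((f.hom ⊗ₘ h.hom) ⊗ₘ (g.hom ⊗ₘ k.hom)) := by
  rw [← hm.natural]
  simp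

theorem m_one_one (hm : IsStrictRelator m) (s t : C) : m (𝟙_ C) (𝟙_ C) s t =
    (λ_ (𝟙_ C)).hom ▷ _ ≫ (λ_ _).hom ≫ ((λ_ s).inv ⊗ₘ (λ_ t).inv) := by
  rw [← hm.left_unit]; simp

theorem m_one_mid (hm : IsStrictRelator m) (s t : C) : m (𝟙_ C) s (𝟙_ C) t =
    ((λ_ s).hom ⊗ₘ (λ_ t).hom) ≫ (λ_ _).inv ≫ (λ_ (𝟙_ C)).inv ▷ _ := by
  have := hm.involutive (𝟙_ C) (𝟙_ C) s t
  rw [hm.m_one_one] at this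
  rw [← cancel_epi ((λ_ (𝟙_ C)).hom ▷ (s ⊗ t) ≫ (λ_ _).hom ≫ ((λ_ s).inv ⊗ₘ (λ_ t).inv)), this]
  simp

theorem left_tensor (hm : IsStrictRelator m) (p s r t q k : C) : m (p ⊗ r) (s ⊗ t) q k =
    m p r s t ▷ (q ⊗ k) ≫ (α_ (p ⊗ s) (r ⊗ t) (q ⊗ k)).hom ≫ (p ⊗ s) ◁ m r t q k ≫
      m p s (r ⊗ q) (t ⊗ k) ≫ ((α_ p r q).inv ⊗ₘ (α_ s t k).inv) := by
  have h := hm.associativity p s r t q k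
  have h2 := congrArg (fun f => m p r s t ▷ (q ⊗ k) ≫ f ≫ ((α_ p r q).inv ⊗ₘ (α_ s t k).inv)) h
  simp only [Category.assoc] at h2
  rw [← h2, ← comp_whiskerRight_assoc, hm.involutive]
  simp

theorem right_tensor (hm : IsStrictRelator m) (p s r t q k : C) : m p s (r ⊗ q) (t ⊗ k) =
    (p ⊗ s) ◁ m r q t k ≫ (α_ (p ⊗ s) (r ⊗ t) (q ⊗ k)).inv ≫ m p s r t ▷ (q ⊗ k) ≫
      m (p ⊗ r) (s ⊗ t) q k ≫ ((α_ p r q).hom ⊗ₘ (α_ s t k).hom) := by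
  rw [hm.associativity]
  simp only [Iso.inv_hom_id_assoc]
  rw [← whiskerLeft_comp_assoc, hm.involutive]
  simp

theorem m_third (hm : IsStrictRelator m) (r s t : C) : m r s (𝟙_ C) t =
    (α_ _ _ _).hom ≫ r ◁ (s ◁ (λ_ t).hom) ≫ (ρ_ r).inv ▷ _ := by
  rw [hm.conj (ρ_ r) (λ_ s) (Iso.refl _) (Iso.refl _), hm.left_tensor, hm.middle_unit,
    hm.m_one_mid, hm.conj (Iso.refl r) (Iso.refl _) (λ_ (𝟙_ C)).symm (Iso.refl (s ⊗ t)),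
    hm.middle_unit]
  simp only [Iso.refl_hom, Iso.refl_inv, Iso.symm_hom, Iso.symm_inv]
  monoidal

theorem m_second (hm : IsStrictRelator m) (r s t : C) : m r (𝟙_ C) s t =
    (ρ_ r).hom ▷ _ ≫ r ◁ (s ◁ (λ_ t).inv) ≫ (α_ _ _ _).inv := by
  have h := hm.involutive r s (𝟙_ C) t
  rw [hm.m_third] at h
  rw [← cancel_epi ((α_ r s (𝟙_ C ⊗ t)).hom ≫ r ◁ s ◁ (λ_ t).hom ≫ (ρ_ r).inv ▷ (s ⊗ t)), h]
  monoidal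

theorem m_first (hm : IsStrictRelator m) (s r t : C) : m (𝟙_ C) s r t =
    (α_ _ _ _).hom ≫ (λ_ _).hom ≫ (α_ _ _ _).inv ≫ sw m s r ▷ t ≫ (α_ _ _ _).hom ≫
      (λ_ r).inv ▷ _ := by
  rw [hm.conj (Iso.refl _) (Iso.refl _) (ρ_ r) (λ_ t), hm.right_tensor, hm.middle_unit,
    hm.m_third]
  simp only [Iso.refl_hom, Iso.refl_inv, sw]
  monoidal

theorem m_eq (hm : IsStrictRelator m) (p s r t : C) : m p s r t =
    (α_ p s (r ⊗ t)).hom ≫ p ◁ (α_ s r t).inv ≫ p ◁ sw m s r ▷ t ≫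
        p ◁ (α_ r s t).hom ≫ (α_ p r (s ⊗ t)).inv := by
  rw [hm.conj (ρ_ p) (λ_ s) (Iso.refl _) (Iso.refl _), hm.left_tensor, hm.middle_unit,
    hm.m_first, hm.m_second]
  simp only [Iso.refl_hom, Iso.refl_inv]
  monoidal

theorem sw_sw (hm : IsStrictRelator m) (r s : C) : sw m r s ≫ sw m s r = 𝟙 _ := by
  have h := hm.involutive (𝟙_ C) r s (𝟙_ C)
  simp only [sw, Category.assoc]
  have e : ((λ_ s).hom ⊗ₘ (ρ_ r).hom) ≫ ((λ_ s).inv ⊗ₘ (ρ_ r).inv) = 𝟙 _ := by monoidal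
  rw [reassoc_of% e, reassoc_of% h]
  monoidal

theorem sw_natural (hm : IsStrictRelator m) {r r' s s' : C} (f : r ⟶ r') (g : s ⟶ s') :
    (f ⊗ₘ g) ≫ sw m r' s' = sw m r s ≫ (g ⊗ₘ f) := by
  have h := hm.natural (𝟙 (𝟙_ C)) f g (𝟙 (𝟙_ C))
  have e : (f ⊗ₘ g) ≫ ((λ_ r').inv ⊗ₘ (ρ_ s').inv) =
      ((λ_ r).inv ⊗ₘ (ρ_ s).inv) ≫ ((𝟙 (𝟙_ C) ⊗ₘ f) ⊗ₘ (g ⊗ₘ 𝟙 (𝟙_ C))) := by monoidal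
  simp only [sw, Category.assoc]
  rw [reassoc_of% e, reassoc_of% h]
  monoidal

theorem hexagon_right (hm : IsStrictRelator m) (x y z : C) : sw m x (y ⊗ z) = (α_ x y z).inv ≫ sw m x y ▷ z ≫
    (α_ y x z).hom ≫ y ◁ sw m x z ≫ (α_ y z x).inv := by
  conv_lhs => rw [sw, hm.conj (Iso.refl _) (Iso.refl _) (Iso.refl _) (λ_ (𝟙_ C)),
    hm.right_tensor, hm.m_third, hm.m_first,
    hm.conj (λ_ y).symm (ρ_ x).symm (Iso.refl _) (Iso.refl _), hm.m_eq]
  simp only [Iso.refl_hom, Iso.refl_inv, Iso.symm_hom, Iso.symm_inv]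
  monoidal

theorem hexagon_left (hm : IsStrictRelator m) (x y z : C) : sw m (x ⊗ y) z = (α_ x y z).hom ≫ x ◁ sw m y z ≫
    (α_ x z y).inv ≫ sw m x z ▷ y ≫ (α_ z x y).hom := by
  have : IsIso (sw m z (x ⊗ y)) := ⟨sw m (x ⊗ y) z, hm.sw_sw _ _, hm.sw_sw _ _⟩
  rw [← cancel_epi (sw m z (x ⊗ y)), hm.sw_sw, hm.hexagon_right]
  simp only [Category.assoc, Iso.inv_hom_id_assoc]
  rw [← whiskerLeft_comp_assoc, hm.sw_sw, whiskerLeft_id, Category.id_comp,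
    Iso.hom_inv_id_assoc, ← comp_whiskerRight_assoc, hm.sw_sw]
  simp

end IsStrictRelator

/-- The symmetric structure given by a strict relator's involution. -/
@[reducible] def symmetricOfRelator (hm : IsStrictRelator m) : SymmetricCategory C where
  braiding x y := ⟨IsStrictRelator.sw m x y, IsStrictRelator.sw m y x, hm.sw_sw x y, hm.sw_sw y x⟩
  braiding_naturality_right x _ _ f := by simpa using hm.sw_natural (𝟙 x) f
  braiding_naturality_left f z := by simpa using hm.sw_natural f (𝟙 z)
  hexagon_forward x y z := by simp [hm.hexagon_right]
  hexagon_reverse x y z := by simp [hm.hexagon_left]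
  symmetry x y := hm.sw_sw x y

end StrictRelator

section

variable {V : Type u} [Category.{v} V] [MonoidalCategory V] [OrderedMonoidal V]
  [RelatorInvolution V]

theorem isStrictRelator_q : IsStrictRelator (C := Bar V)
    (fun p s r t => q (RelatorInvolution.m p.as s.as r.as t.as)) where
  natural f g h k := by
    obtain ⟨f, rfl⟩ := q_surj f
    obtain ⟨g, rfl⟩ := q_surj g
    obtain ⟨h, rfl⟩ := q_surj h
    obtain ⟨k, rfl⟩ := q_surj k
    exact sim_iff.1 (RelatorInvolution.natural f g h k)
  involutive p s r t := sim_iff.1 (RelatorInvolution.involutive p.as s.as r.as t.as)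
  associativity p s r t a k :=
    sim_iff.1 (RelatorInvolution.associativity p.as s.as r.as t.as a.as k.as)
  left_unit p s := sim_iff.1 (RelatorInvolution.left_unit p.as s.as)
  right_unit p s := sim_iff.1 (RelatorInvolution.right_unit p.as s.as)
  middle_unit p t := sim_iff.1 (RelatorInvolution.middle_unit p.as t.as)

instance : SymmetricCategory (Bar V) := symmetricOfRelator isStrictRelator_q

theorem q_swap (r s : V) : q (swap r s) = (β_ (Bar.mk r) (Bar.mk s)).hom := rfl

theorem q_m (p s r t : V) :
    q (RelatorInvolution.m p s r t) =
      tensorμ (Bar.mk p) (Bar.mk s) (Bar.mk r) (Bar.mk t) :=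
  isStrictRelator_q.m_eq (Bar.mk p) (Bar.mk s) (Bar.mk r) (Bar.mk t)

end
end VLax
namespace VLax

section Complete

variable {V : Type u} [Category.{v} V] [MonoidalCategory V] [OrderedMonoidal V]

/-- The exponential object `t ^ s` of the values category: the coadjoint of `- ⊗ s`. -/
def power [∀ s : V, (tensorRight s).IsLeftAdjoint] (t s : V) : V :=
  (Functor.rightAdjoint (tensorRight s)).obj t

/-- The bijective name appointment `V(r ⊗ s; t) → V(r; t ^ s)`. -/
def nameEquiv [∀ s : V, (tensorRight s).IsLeftAdjoint] (r s t : V) :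
    (r ⊗ s ⟶ t) ≃ (r ⟶ power t s) :=
  (Adjunction.ofIsLeftAdjoint (tensorRight s)).homEquiv r t

/-- The inverse image of the similarity relation along a pair of arrows `f, g : p ⟶ r`: an arrow
`ι : obj ⟶ p`, monic and order-reflecting, through which exactly those arrows `h` factor that
satisfy `h ≫ f ∼ h ≫ g`. -/
structure SimInverseImage {p r : V} (f g : p ⟶ r) where
  obj : V
  ι : obj ⟶ p
  condition : ι ≫ f ∼ ι ≫ g
  lift : ∀ {s : V} (h : s ⟶ p), h ≫ f ∼ h ≫ g → (s ⟶ obj)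
  lift_ι : ∀ {s : V} (h : s ⟶ p) (w : h ≫ f ∼ h ≫ g), lift h w ≫ ι = h
  hom_ext : ∀ {s : V} (h k : s ⟶ obj), h ≫ ι = k ≫ ι → h = k
  le_of_le : ∀ {s : V} (h k : s ⟶ obj), h ≫ ι ≤ k ≫ ι → h ≤ k

variable (V) in
/-- The order-theoretic completeness of a values category with small products (`t` is the universe
of small sets) and exponential objects: products carry the initial order for their projections, the
name appointment respects similarity, and inverse images of the similarity relation exist. -/
class ValuesComplete [∀ s : V, (tensorRight s).IsLeftAdjoint] [HasProducts.{t} V] : Prop where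
  le_of_proj : ∀ {J : Type t} (p : J → V) {r : V} (f g : r ⟶ ∏ᶜ p),
    (∀ j, f ≫ Pi.π p j ≤ g ≫ Pi.π p j) → f ≤ g
  name_sim : ∀ {r s t : V} {f g : r ⊗ s ⟶ t}, f ∼ g → nameEquiv r s t f ∼ nameEquiv r s t g
  inverseImage : ∀ {p r : V} (f g : p ⟶ r), Nonempty (SimInverseImage f g)

end Complete

/-! ### Graphs and transports -/

section Graphs

/-- A `V`-graph with chosen unit arrow mappings and contact arrows mappings (no laws). -/
structure VGraph (V : Type u) [Category.{v} V] [MonoidalCategory V] where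
  Obj : Type w
  Hom : Obj → Obj → V
  one : ∀ x, 𝟙_ V ⟶ Hom x x
  comp : ∀ x y z, Hom x y ⊗ Hom y z ⟶ Hom x z

/-- A transport of `V`-graphs (no laws). -/
@[ext]
structure Transport {V : Type u} [Category.{v} V] [MonoidalCategory V]
    (X : VGraph.{w} V) (Y : VGraph.{w'} V) where
  obj : X.Obj → Y.Obj
  map : ∀ x y, X.Hom x y ⟶ Y.Hom (obj x) (obj y)

variable {V : Type u} [Category.{v} V] [MonoidalCategory V]

namespace Transport

/-- Identity transport. -/
abbrev id (X : VGraph.{w} V) : Transport X X := ⟨fun x => x, fun _ _ => 𝟙 _⟩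

/-- Composition of transports. -/
abbrev comp {X : VGraph.{w} V} {Y : VGraph.{w'} V} {Z : VGraph.{w''} V} (f : Transport X Y)
    (g : Transport Y Z) : Transport X Z :=
  ⟨fun x => g.obj (f.obj x), fun x y => f.map x y ≫ g.map _ _⟩

end Transport

variable [OrderedMonoidal V]

/-- A lax `V`-enriched category: the unit arrows are neutral and the contact arrows mappings are
associative up to canonical isomorphism. -/
structure VGraph.IsLaxCat (X : VGraph.{w} V) : Prop where
  one_comp : ∀ x y, (λ_ (X.Hom x y)).inv ≫ X.one x ▷ X.Hom x y ≫ X.comp x x y ∼ 𝟙 _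
  comp_one : ∀ x y, (ρ_ (X.Hom x y)).inv ≫ X.Hom x y ◁ X.one y ≫ X.comp x y y ∼ 𝟙 _
  assoc : ∀ x y z a, (α_ (X.Hom x y) (X.Hom y z) (X.Hom z a)).hom ≫
    X.Hom x y ◁ X.comp y z a ≫ X.comp x y a ∼ X.comp x y z ▷ X.Hom z a ≫ X.comp x z a

namespace Transport

variable {X : VGraph.{w} V} {Y : VGraph.{w'} V}

/-- A transport of original `V`-graphs: unit arrow mappings are maintained up to canonical
isomorphism. -/
def IsOriginal (f : Transport X Y) : Prop := ∀ x, X.one x ≫ f.map x x ∼ Y.one (f.obj x)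

/-- A laxly natural functor: unit arrow mappings and contact arrows mappings are maintained up to
canonical isomorphism. -/
structure IsLaxNatural (f : Transport X Y) : Prop where
  map_one : f.IsOriginal
  map_comp : ∀ x y z, X.comp x y z ≫ f.map x z ∼
    (f.map x y ⊗ₘ f.map y z) ≫ Y.comp (f.obj x) (f.obj y) (f.obj z)

/-- The order between parallel transports (those with the same appointment of vertexes). -/
def LE (f g : Transport X Y) : Prop :=
  ∃ h : ∀ x, f.obj x = g.obj x,
    ∀ x y, f.map x y ≫ eqToHom (by rw [h x, h y]) ≤ g.map x y

/-- Parallel transports that are equal up to canonical isomorphism. -/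
def Sim (f g : Transport X Y) : Prop := f.LE g ∧ g.LE f

end Transport

/-! ### The biproduct with an assistant graph -/

section Biproduct

variable [RelatorInvolution V]

/-- The biproduct `X ⊗ T`; its contact arrows mappings are defined with the relator's
involution. -/
abbrev VGraph.tensor (X : VGraph.{w} V) (T : VGraph.{w'} V) : VGraph.{max w w'} V where
  Obj := X.Obj × T.Obj
  Hom a b := X.Hom a.1 b.1 ⊗ T.Hom a.2 b.2
  one a := (λ_ (𝟙_ V)).inv ≫ (X.one a.1 ⊗ₘ T.one a.2)
  comp a b c := RelatorInvolution.m _ _ _ _ ≫ (X.comp a.1 b.1 c.1 ⊗ₘ T.comp a.2 b.2 c.2)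

/-- The biproduct `f ⊗ Id_T` of a transport with the identity transport of `T`. -/
abbrev Transport.tensorId {X : VGraph.{w} V} {Y : VGraph.{w'} V} (f : Transport X Y)
    (T : VGraph.{w''} V) : Transport (X.tensor T) (Y.tensor T) where
  obj a := (f.obj a.1, a.2)
  map a b := f.map a.1 b.1 ▷ T.Hom a.2 b.2

end Biproduct

/-! ### The exponential space of all transforms -/

section Exponential

variable [HasProducts.{t} V]

/-- The object of all transforms between two transports: the product `∏ₛ Y(φ s; ψ s)`. -/
def transforms {Y : VGraph.{w} V} {T : VGraph.{t} V} (φ ψ : Transport T Y) : V :=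
  ∏ᶜ fun s : T.Obj => Y.Hom (φ.obj s) (ψ.obj s)

/-- The component of transforms at a vertex `s`. -/
def component {Y : VGraph.{w} V} {T : VGraph.{t} V} (φ ψ : Transport T Y) (s : T.Obj) :
    transforms φ ψ ⟶ Y.Hom (φ.obj s) (ψ.obj s) :=
  Pi.π (fun s : T.Obj => Y.Hom (φ.obj s) (ψ.obj s)) s

/-- The arrow to the object of all transforms with given components. -/
def liftTransforms {Y : VGraph.{w} V} {T : VGraph.{t} V} {φ ψ : Transport T Y} {r : V}
    (h : ∀ s, r ⟶ Y.Hom (φ.obj s) (ψ.obj s)) : r ⟶ transforms φ ψ :=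
  Pi.lift h

@[simp]
theorem lift_component {Y : VGraph.{w} V} {T : VGraph.{t} V} {φ ψ : Transport T Y} {r : V}
    (h : ∀ s, r ⟶ Y.Hom (φ.obj s) (ψ.obj s)) (s : T.Obj) :
    liftTransforms h ≫ component φ ψ s = h s :=
  Pi.lift_π h s

theorem transforms_ext {Y : VGraph.{w} V} {T : VGraph.{t} V} {φ ψ : Transport T Y} {r : V}
    {h k : r ⟶ transforms φ ψ} (e : ∀ s, h ≫ component φ ψ s = k ≫ component φ ψ s) : h = k :=
  Pi.hom_ext _ _ e

/-- The exponential space `Y ^ T` of all transforms between all transports `T → Y`. -/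
abbrev VGraph.exp (Y : VGraph.{w} V) (T : VGraph.{t} V) : VGraph.{max t v w} V where
  Obj := Transport T Y
  Hom φ ψ := transforms φ ψ
  one φ := liftTransforms fun s => Y.one (φ.obj s)
  comp φ ψ ξ := liftTransforms fun s =>
    (component φ ψ s ⊗ₘ component ψ ξ s) ≫ Y.comp (φ.obj s) (ψ.obj s) (ξ.obj s)

/-- The changing of target space `f ^ T : X ^ T → Y ^ T`. -/
abbrev Transport.exp {X : VGraph.{w} V} {Y : VGraph.{w'} V} (f : Transport X Y)
    (T : VGraph.{t} V) : Transport (X.exp T) (Y.exp T) where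
  obj φ := φ.comp f
  map φ ψ := liftTransforms fun s => component φ ψ s ≫ f.map (φ.obj s) (ψ.obj s)

/-- The secondary order between transports to an exponential space: the appointed transports
`T → Y` are parallel and ordered, and so are all components of the mappings of edges sets. -/
def Transport.SecLE {X : VGraph.{w} V} {Y : VGraph.{w'} V} {T : VGraph.{t} V}
    (g g' : Transport X (Y.exp T)) : Prop :=
  ∃ h : ∀ a s, (g.obj a).obj s = (g'.obj a).obj s,
    (∀ a, (g.obj a).LE (g'.obj a)) ∧
    ∀ a b s, (g.map a b ≫ component (g.obj a) (g.obj b) s) ≫ eqToHom (by rw [h a s, h b s]) ≤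
      g'.map a b ≫ component (g'.obj a) (g'.obj b) s

/-- Equality up to canonical isomorphism of transports to an exponential space. -/
def Transport.SecSim {X : VGraph.{w} V} {Y : VGraph.{w'} V} {T : VGraph.{t} V}
    (g g' : Transport X (Y.exp T)) : Prop := g.SecLE g' ∧ g'.SecLE g

variable [RelatorInvolution V]

/-- The sections transport `λ_X : X → (X ⊗ T) ^ T`. The vertex `a` goes to the section
`s ↦ ⟨a, s⟩` with edges set mappings `T(s;t) → 1_a ⊗ T(s;t)`; the edges set `X(a;b)` goes to the
product of the `X(a;b) ⊗ 1_s`. -/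
abbrev VGraph.sections (X : VGraph.{w} V) (T : VGraph.{t} V) : Transport X ((X.tensor T).exp T) where
  obj a := ⟨fun s => (a, s), fun s t => (λ_ (T.Hom s t)).inv ≫ X.one a ▷ T.Hom s t⟩
  map a b := liftTransforms fun s => (ρ_ (X.Hom a b)).inv ≫ X.Hom a b ◁ T.one s

/-- The precontact arrows `Y(φ s; ψ s) ∘ ψ(T(s;s'))` of transforms. -/
def precontact {Y : VGraph.{w} V} {T : VGraph.{t} V} (φ ψ : Transport T Y) (s s' : T.Obj) :
    transforms φ ψ ⊗ T.Hom s s' ⟶ Y.Hom (φ.obj s) (ψ.obj s') :=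
  (component φ ψ s ⊗ₘ ψ.map s s') ≫ Y.comp (φ.obj s) (ψ.obj s) (ψ.obj s')

/-- The postcontact arrows `φ(T(s;s')) ∘ Y(φ s'; ψ s')` of transforms. -/
def postcontact {Y : VGraph.{w} V} {T : VGraph.{t} V} (φ ψ : Transport T Y) (s s' : T.Obj) :
    transforms φ ψ ⊗ T.Hom s s' ⟶ Y.Hom (φ.obj s) (ψ.obj s') :=
  swap _ _ ≫ (φ.map s s' ⊗ₘ component φ ψ s') ≫ Y.comp (φ.obj s) (φ.obj s') (ψ.obj s')

/-- The preevaluation `ev⁺`, defined with precontact arrows. -/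
abbrev VGraph.preEval (Y : VGraph.{w} V) (T : VGraph.{t} V) : Transport ((Y.exp T).tensor T) Y where
  obj a := a.1.obj a.2
  map a b := precontact a.1 b.1 a.2 b.2

/-- The postevaluation `ev⁻`, defined with postcontact arrows. -/
abbrev VGraph.postEval (Y : VGraph.{w} V) (T : VGraph.{t} V) : Transport ((Y.exp T).tensor T) Y where
  obj a := a.1.obj a.2
  map a b := postcontact a.1 b.1 a.2 b.2

variable {X : VGraph.{w} V} {Y : VGraph.{w'} V} {T : VGraph.{t} V}

/-- The name of a form. -/
def Transport.name (f : Transport (X.tensor T) Y) : Transport X (Y.exp T) :=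
  (X.sections T).comp (f.exp T)

/-- The prerealization of a name form. -/
def Transport.preReal (g : Transport X (Y.exp T)) : Transport (X.tensor T) Y :=
  (g.tensorId T).comp (Y.preEval T)

/-- The postrealization of a name form. -/
def Transport.postReal (g : Transport X (Y.exp T)) : Transport (X.tensor T) Y :=
  (g.tensorId T).comp (Y.postEval T)

end Exponential

/-! ### The category of lax categories and laxly natural functors -/

variable (V) in
/-- Lax `V`-enriched categories. -/
structure LaxCat extends VGraph.{w} V where
  isLax : toVGraph.IsLaxCat

/-- Laxly natural functors between lax `V`-enriched categories. -/
@[ext]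
structure LaxFun (X : LaxCat.{w} V) (Y : LaxCat.{w'} V) extends
    Transport X.toVGraph Y.toVGraph where
  isLaxNatural : toTransport.IsLaxNatural

end Graphs
end VLax
namespace VLax

section StrictLemmas

variable {C : Type u} [Category.{v} C] [MonoidalCategory C] [SymmetricCategory C]

theorem tensor_one_comp {A B P Q P' Q' : C} (a : 𝟙_ C ⟶ A) (b : 𝟙_ C ⟶ B)
    (c : A ⊗ P ⟶ P') (d : B ⊗ Q ⟶ Q') :
    (λ_ (P ⊗ Q)).inv ≫ ((λ_ (𝟙_ C)).inv ≫ (a ⊗ₘ b)) ▷ (P ⊗ Q) ≫ tensorμ A B P Q ≫ (c ⊗ₘ d) =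
      ((λ_ P).inv ≫ a ▷ P ≫ c) ⊗ₘ ((λ_ Q).inv ≫ b ▷ Q ≫ d) := by
  rw [← cancel_epi (λ_ (P ⊗ Q)).hom, Iso.hom_inv_id_assoc, comp_whiskerRight, Category.assoc,
    tensorμ_natural_left_assoc, tensor_left_unitality]
  simp only [Category.assoc, tensorHom_comp_tensorHom, Iso.hom_inv_id_assoc]

theorem tensor_comp_one {A B P Q P' Q' : C} (a : 𝟙_ C ⟶ A) (b : 𝟙_ C ⟶ B)
    (c : P ⊗ A ⟶ P') (d : Q ⊗ B ⟶ Q') :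
    (ρ_ (P ⊗ Q)).inv ≫ (P ⊗ Q) ◁ ((λ_ (𝟙_ C)).inv ≫ (a ⊗ₘ b)) ≫ tensorμ P Q A B ≫ (c ⊗ₘ d) =
      ((ρ_ P).inv ≫ P ◁ a ≫ c) ⊗ₘ ((ρ_ Q).inv ≫ Q ◁ b ≫ d) := by
  rw [← cancel_epi (ρ_ (P ⊗ Q)).hom, Iso.hom_inv_id_assoc, whiskerLeft_comp, Category.assoc,
    tensorμ_natural_right_assoc, tensor_right_unitality]
  simp only [Category.assoc, tensorHom_comp_tensorHom, Iso.hom_inv_id_assoc]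

theorem tensor_assoc {A₁ A₂ A₃ A₁₂ A₂₃ A B₁ B₂ B₃ B₁₂ B₂₃ B : C}
    (a₁₂ : A₁ ⊗ A₂ ⟶ A₁₂) (a₂₃ : A₂ ⊗ A₃ ⟶ A₂₃) (a : A₁₂ ⊗ A₃ ⟶ A) (a' : A₁ ⊗ A₂₃ ⟶ A)
    (b₁₂ : B₁ ⊗ B₂ ⟶ B₁₂) (b₂₃ : B₂ ⊗ B₃ ⟶ B₂₃) (b : B₁₂ ⊗ B₃ ⟶ B) (b' : B₁ ⊗ B₂₃ ⟶ B)
    (ha : (α_ A₁ A₂ A₃).hom ≫ A₁ ◁ a₂₃ ≫ a' = a₁₂ ▷ A₃ ≫ a)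
    (hb : (α_ B₁ B₂ B₃).hom ≫ B₁ ◁ b₂₃ ≫ b' = b₁₂ ▷ B₃ ≫ b) :
    (α_ (A₁ ⊗ B₁) (A₂ ⊗ B₂) (A₃ ⊗ B₃)).hom ≫
      (A₁ ⊗ B₁) ◁ (tensorμ A₂ B₂ A₃ B₃ ≫ (a₂₃ ⊗ₘ b₂₃)) ≫ tensorμ A₁ B₁ A₂₃ B₂₃ ≫ (a' ⊗ₘ b') =
    (tensorμ A₁ B₁ A₂ B₂ ≫ (a₁₂ ⊗ₘ b₁₂)) ▷ (A₃ ⊗ B₃) ≫ tensorμ A₁₂ B₁₂ A₃ B₃ ≫ (a ⊗ₘ b) := by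
  rw [whiskerLeft_comp, comp_whiskerRight, Category.assoc, Category.assoc,
    tensorμ_natural_left_assoc, tensorμ_natural_right_assoc, tensorHom_comp_tensorHom,
    tensorHom_comp_tensorHom, ← ha, ← hb, ← tensor_associativity_assoc,
    tensorHom_comp_tensorHom]

/-- Auxiliary: an enriched category in the strict sense. -/
structure IsStrictCat (X : VGraph.{w} C) : Prop where
  one_comp : ∀ x y, (λ_ (X.Hom x y)).inv ≫ X.one x ▷ X.Hom x y ≫ X.comp x x y = 𝟙 _
  comp_one : ∀ x y, (ρ_ (X.Hom x y)).inv ≫ X.Hom x y ◁ X.one y ≫ X.comp x y y = 𝟙 _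
  assoc : ∀ x y z a, (α_ (X.Hom x y) (X.Hom y z) (X.Hom z a)).hom ≫
    X.Hom x y ◁ X.comp y z a ≫ X.comp x y a = X.comp x y z ▷ X.Hom z a ≫ X.comp x z a

variable {Y : VGraph.{w} C}

theorem IsStrictCat.one_comp' (hY : IsStrictCat Y) {x y : Y.Obj} {U : C} (u : U ⟶ Y.Hom x y) :
    (Y.one x ⊗ₘ u) ≫ Y.comp x x y = (λ_ U).hom ≫ u := by
  have h := hY.one_comp x y
  rw [← cancel_epi (λ_ U).inv, tensorHom_def', Category.assoc, ← leftUnitor_inv_naturality_assoc, h]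
  simp

theorem IsStrictCat.comp_one' (hY : IsStrictCat Y) {x y : Y.Obj} {U : C} (u : U ⟶ Y.Hom x y) :
    (u ⊗ₘ Y.one y) ≫ Y.comp x y y = (ρ_ U).hom ≫ u := by
  have h := hY.comp_one x y
  rw [← cancel_epi (ρ_ U).inv, MonoidalCategory.tensorHom_def, Category.assoc, ← rightUnitor_inv_naturality_assoc, h]
  simp

/-- Composite of two generalized arrows. -/
def cc {x y z : Y.Obj} {A B : C} (a : A ⟶ Y.Hom x y) (b : B ⟶ Y.Hom y z) : A ⊗ B ⟶ Y.Hom x z :=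
  (a ⊗ₘ b) ≫ Y.comp x y z

theorem cc_pre {x y z : Y.Obj} {A B A' B' : C} (f : A' ⟶ A) (g : B' ⟶ B) (a : A ⟶ Y.Hom x y)
    (b : B ⟶ Y.Hom y z) : cc (f ≫ a) (g ≫ b) = (f ⊗ₘ g) ≫ cc a b := by
  rw [cc, cc, tensorHom_comp_tensorHom_assoc]

theorem cc_preL {x y z : Y.Obj} {A B A' : C} (f : A' ⟶ A) (a : A ⟶ Y.Hom x y)
    (b : B ⟶ Y.Hom y z) : cc (f ≫ a) b = f ▷ B ≫ cc a b := by
  simpa using cc_pre f (𝟙 B) a b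

theorem cc_preR {x y z : Y.Obj} {A B B' : C} (g : B' ⟶ B) (a : A ⟶ Y.Hom x y)
    (b : B ⟶ Y.Hom y z) : cc a (g ≫ b) = A ◁ g ≫ cc a b := by
  simpa using cc_pre (𝟙 A) g a b

theorem IsStrictCat.cc_assoc (hY : IsStrictCat Y) {x y z k : Y.Obj} {A B D : C}
    (a : A ⟶ Y.Hom x y) (b : B ⟶ Y.Hom y z) (d : D ⟶ Y.Hom z k) :
    cc (cc a b) d = (α_ A B D).hom ≫ cc a (cc b d) := by
  have e : cc (cc a b) d = ((a ⊗ₘ b) ⊗ₘ d) ≫ Y.comp x y z ▷ _ ≫ Y.comp x z k := by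
    rw [cc, cc, ← tensorHom_id, tensorHom_comp_tensorHom_assoc, Category.comp_id]
  have e' : cc a (cc b d) = (a ⊗ₘ (b ⊗ₘ d)) ≫ _ ◁ Y.comp y z k ≫ Y.comp x y k := by
    rw [cc, cc, ← id_tensorHom, tensorHom_comp_tensorHom_assoc, Category.comp_id]
  rw [e, e', ← hY.assoc, associator_naturality_assoc]

/-- the composite of two natural transforms is natural -/
theorem IsStrictCat.natural_comp (hY : IsStrictCat Y) {x y z x' y' z' : Y.Obj} {A B U : C}
    (as : A ⟶ Y.Hom x y) (at' : A ⟶ Y.Hom x' y') (bs : B ⟶ Y.Hom y z) (bt : B ⟶ Y.Hom y' z')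
    (φ : U ⟶ Y.Hom x x') (ψ : U ⟶ Y.Hom y y') (ξ : U ⟶ Y.Hom z z')
    (ha : cc as ψ = (β_ A U).hom ≫ cc φ at') (hb : cc bs ξ = (β_ B U).hom ≫ cc ψ bt) :
    cc (cc as bs) ξ = (β_ (A ⊗ B) U).hom ≫ cc φ (cc at' bt) := by
  rw [hY.cc_assoc, hb, cc_preR]
  have h1 := hY.cc_assoc as ψ bt
  have h2 := hY.cc_assoc φ at' bt
  rw [← cancel_epi (α_ _ _ _).inv, Iso.inv_hom_id_assoc] at h1 h2
  rw [← h1, ← h2, ha, cc_preL]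
  simp

/-- preevaluation maintains composition -/
theorem IsStrictCat.preEval_comp (hY : IsStrictCat Y) {x y z y' z' z'' : Y.Obj} {A B U W : C}
    (as : A ⟶ Y.Hom x y) (bs : B ⟶ Y.Hom y z) (bt : B ⟶ Y.Hom y' z')
    (ψ : U ⟶ Y.Hom y y') (ξ : U ⟶ Y.Hom z z') (ξ' : W ⟶ Y.Hom z' z'')
    (hb : cc bs ξ = (β_ B U).hom ≫ cc ψ bt) :
    tensorμ A U B W ≫ cc (cc as bs) (cc ξ ξ') = cc (cc as ψ) (cc bt ξ') := by
  have h1 : cc bs (cc ξ ξ') = (α_ _ _ _).inv ≫ cc (cc bs ξ) ξ' := by simp [hY.cc_assoc]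
  have h2 : cc ψ (cc bt ξ') = (α_ _ _ _).inv ≫ cc (cc ψ bt) ξ' := by simp [hY.cc_assoc]
  rw [hY.cc_assoc, h1, hY.cc_assoc as, h2, cc_preR, cc_preR, hb, cc_preL, cc_preR]
  simp only [tensorμ, Category.assoc, Iso.inv_hom_id_assoc]
  have e : A ◁ (β_ U B).hom ▷ W ≫ A ◁ (β_ B U).hom ▷ W = 𝟙 _ := by
    rw [← whiskerLeft_comp, ← comp_whiskerRight, SymmetricCategory.symmetry]
    simp
  rw [← whiskerLeft_comp_assoc A (α_ B U W).hom, Iso.hom_inv_id, whiskerLeft_id,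
    Category.id_comp, reassoc_of% e]

/-- the decomposition of a biproduct of arrows, unit on the inner places -/
theorem tensor_pre {A A' P Q Q' R : C} (a : 𝟙_ C ⟶ A) (b : 𝟙_ C ⟶ A') (c : P ⊗ A' ⟶ Q)
    (d : A ⊗ R ⟶ Q') :
    (((ρ_ P).inv ≫ P ◁ a) ⊗ₘ ((λ_ R).inv ≫ b ▷ R)) ≫ tensorμ P A A' R ≫ (c ⊗ₘ d) =
      ((ρ_ P).inv ≫ P ◁ b ≫ c) ⊗ₘ ((λ_ R).inv ≫ a ▷ R ≫ d) := by
  have h := tensorμ_natural (𝟙 P) a b (𝟙 R)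
  simp only [id_tensorHom, tensorHom_id] at h
  have e : ((ρ_ P).inv ⊗ₘ (λ_ R).inv) ≫ tensorμ P (𝟙_ C) (𝟙_ C) R =
      ((ρ_ P).inv ⊗ₘ (λ_ R).inv) := by
    simp only [tensorμ, braiding_tensorUnit_left]
    monoidal
  rw [← tensorHom_comp_tensorHom, Category.assoc, reassoc_of% h, reassoc_of% e,
    tensorHom_comp_tensorHom, tensorHom_comp_tensorHom]

/-- the decomposition of a biproduct of arrows, unit on the outer places -/
theorem tensor_post {A A' P Q Q' R : C} (a : 𝟙_ C ⟶ A) (b : 𝟙_ C ⟶ A') (c : A ⊗ P ⟶ Q)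
    (d : R ⊗ A' ⟶ Q') :
    (β_ P R).hom ≫ (((λ_ R).inv ≫ a ▷ R) ⊗ₘ ((ρ_ P).inv ≫ P ◁ b)) ≫ tensorμ A R P A' ≫ (c ⊗ₘ d) =
      ((λ_ P).inv ≫ a ▷ P ≫ c) ⊗ₘ ((ρ_ R).inv ≫ R ◁ b ≫ d) := by
  have h := tensorμ_natural a (𝟙 R) (𝟙 P) b
  simp only [id_tensorHom, tensorHom_id] at h
  have e : ((λ_ R).inv ⊗ₘ (ρ_ P).inv) ≫ tensorμ (𝟙_ C) R P (𝟙_ C) =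
      (β_ R P).hom ≫ ((λ_ P).inv ⊗ₘ (ρ_ R).inv) := by
    simp only [tensorμ]
    monoidal
  rw [← tensorHom_comp_tensorHom, Category.assoc, reassoc_of% h, reassoc_of% e,
    SymmetricCategory.symmetry_assoc, tensorHom_comp_tensorHom, tensorHom_comp_tensorHom]

theorem tensor_sec {A A' A'' P Q R : C} (a : 𝟙_ C ⟶ A) (b : 𝟙_ C ⟶ A') (e : 𝟙_ C ⟶ A'')
    (c : A ⊗ A' ⟶ A'') (d : P ⊗ Q ⟶ R) (h : (a ⊗ₘ b) ≫ c = (λ_ _).hom ≫ e) :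
    (((λ_ P).inv ≫ a ▷ P) ⊗ₘ ((λ_ Q).inv ≫ b ▷ Q)) ≫ tensorμ A P A' Q ≫ (c ⊗ₘ d) =
      d ≫ (λ_ R).inv ≫ e ▷ R := by
  have h1 := tensorμ_natural a (𝟙 P) b (𝟙 Q)
  simp only [id_tensorHom, tensorHom_id] at h1
  have e1 : ((λ_ P).inv ⊗ₘ (λ_ Q).inv) ≫ tensorμ (𝟙_ C) P (𝟙_ C) Q =
      (λ_ (P ⊗ Q)).inv ≫ (λ_ (𝟙_ C)).inv ▷ (P ⊗ Q) := by
    simp only [tensorμ, braiding_tensorUnit_right]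
    monoidal
  rw [← tensorHom_comp_tensorHom, Category.assoc, reassoc_of% h1, reassoc_of% e1,
    tensorHom_comp_tensorHom, h, id_whiskerRight, Category.id_comp, leftUnitor_inv_naturality_assoc]
  simp only [← tensorHom_id, ← id_tensorHom, tensorHom_comp_tensorHom, Iso.inv_hom_id_assoc,
    Category.id_comp, Category.comp_id]

theorem tensor_lam {B B' B'' P Q R : C} (a : 𝟙_ C ⟶ B) (b : 𝟙_ C ⟶ B') (e : 𝟙_ C ⟶ B'')
    (c : P ⊗ Q ⟶ R) (d : B ⊗ B' ⟶ B'') (h : (a ⊗ₘ b) ≫ d = (λ_ _).hom ≫ e) :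
    (((ρ_ P).inv ≫ P ◁ a) ⊗ₘ ((ρ_ Q).inv ≫ Q ◁ b)) ≫ tensorμ P B Q B' ≫ (c ⊗ₘ d) =
      c ≫ (ρ_ R).inv ≫ R ◁ e := by
  have h1 := tensorμ_natural (𝟙 P) a (𝟙 Q) b
  simp only [id_tensorHom, tensorHom_id] at h1
  have e1 : ((ρ_ P).inv ⊗ₘ (ρ_ Q).inv) ≫ tensorμ P (𝟙_ C) Q (𝟙_ C) =
      (ρ_ (P ⊗ Q)).inv ≫ (P ⊗ Q) ◁ (λ_ (𝟙_ C)).inv := by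
    simp only [tensorμ, braiding_tensorUnit_left]
    monoidal
  rw [← tensorHom_comp_tensorHom, Category.assoc, reassoc_of% h1, reassoc_of% e1,
    tensorHom_comp_tensorHom, h, id_whiskerRight, Category.id_comp, rightUnitor_inv_naturality_assoc]
  simp only [← tensorHom_id, ← id_tensorHom, tensorHom_comp_tensorHom, Iso.inv_hom_id_assoc,
    Category.id_comp, Category.comp_id]

end StrictLemmas
end VLax
namespace VLax

section Lax

variable {V : Type u} [Category.{v} V] [MonoidalCategory V] [OrderedMonoidal V]

/-- Auxiliary: the `V`-graph in the quotient category. -/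
abbrev VGraph.bar (X : VGraph.{w} V) : VGraph.{w} (Bar V) where
  Obj := X.Obj
  Hom x y := ⟨X.Hom x y⟩
  one x := q (X.one x)
  comp x y z := q (X.comp x y z)

theorem VGraph.IsLaxCat.bar {X : VGraph.{w} V} (h : X.IsLaxCat) : IsStrictCat X.bar where
  one_comp x y := sim_iff.1 (h.one_comp x y)
  comp_one x y := sim_iff.1 (h.comp_one x y)
  assoc x y z a := sim_iff.1 (h.assoc x y z a)

theorem LaxFun.q_map_comp {X : LaxCat.{w} V} {Y : LaxCat.{w'} V} (f : LaxFun X Y)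
    (x y z : X.Obj) : q (X.comp x y z) ≫ q (f.map x z) =
      cc (Y := Y.bar) (q (f.map x y)) (q (f.map y z)) :=
  sim_iff.1 (f.isLaxNatural.map_comp x y z)

theorem LaxFun.q_map_one {X : LaxCat.{w} V} {Y : LaxCat.{w'} V} (f : LaxFun X Y)
    (x : X.Obj) : q (X.one x) ≫ q (f.map x x) = q (Y.one (f.obj x)) :=
  sim_iff.1 (f.isLaxNatural.map_one x)

theorem Transport.IsLaxNatural.comp {X : VGraph.{w} V} {Y : VGraph.{w'} V} {Z : VGraph.{w''} V}
    {f : Transport X Y} {g : Transport Y Z} (hf : f.IsLaxNatural) (hg : g.IsLaxNatural) :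
    (f.comp g).IsLaxNatural where
  map_one x := by
    have h1 := sim_iff.1 (hf.map_one x)
    have h2 := sim_iff.1 (hg.map_one (f.obj x))
    refine sim_iff.2 ?_
    rw [q_comp] at h1 h2
    simp only [Transport.comp, q_comp]
    rw [reassoc_of% h1, h2]
  map_comp x y z := by
    have h1 := sim_iff.1 (hf.map_comp x y z)
    have h2 := sim_iff.1 (hg.map_comp (f.obj x) (f.obj y) (f.obj z))
    refine sim_iff.2 ?_
    rw [q_comp, q_comp] at h1 h2
    simp only [Transport.comp, q_comp, ← tensorHom_comp_tensorHom]
    rw [reassoc_of% h1, h2, Category.assoc]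

/-- Composition of laxly natural functors. -/
abbrev LaxFun.comp {X : LaxCat.{w} V} {Y : LaxCat.{w'} V} {Z : LaxCat.{w''} V}
    (f : LaxFun X Y) (g : LaxFun Y Z) : LaxFun X Z :=
  ⟨f.toTransport.comp g.toTransport, f.isLaxNatural.comp g.isLaxNatural⟩

/-- The identity functor. -/
abbrev LaxFun.id (X : LaxCat.{w} V) : LaxFun X X where
  toTransport := Transport.id X.toVGraph
  isLaxNatural :=
    { map_one := fun x => by
        simp only [Transport.id, Category.comp_id]; exact Sim.refl _
      map_comp := fun x y z => by
        simp only [Transport.id, Category.comp_id, id_tensorHom_id, Category.id_comp]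
        exact Sim.refl _ }

theorem LaxFun.comp_id {X : LaxCat.{w} V} {Y : LaxCat.{w'} V} (f : LaxFun X Y) :
    f.comp (LaxFun.id Y) = f :=
  LaxFun.ext rfl (by refine heq_of_eq ?_; funext x y; exact Category.comp_id _)

theorem LaxFun.comp_assoc {X : LaxCat.{w} V} {Y : LaxCat.{w'} V} {Z : LaxCat.{w''} V}
    {U : LaxCat.{t} V} (f : LaxFun X Y) (g : LaxFun Y Z) (h : LaxFun Z U) :
    (f.comp g).comp h = f.comp (g.comp h) :=
  LaxFun.ext rfl (by refine heq_of_eq ?_; funext x y; exact Category.assoc _ _ _)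

/-- The category `Catl` of lax `V`-enriched categories and laxly natural functors. -/
instance : Category (LaxCat.{w} V) where
  Hom X Y := LaxFun X Y
  id X := LaxFun.id X
  comp f g := f.comp g
  id_comp f := LaxFun.ext rfl (by
    refine heq_of_eq ?_; funext x y; exact Category.id_comp _)
  comp_id f := LaxFun.ext rfl (by
    refine heq_of_eq ?_; funext x y; exact Category.comp_id _)
  assoc f g h := LaxFun.ext rfl (by
    refine heq_of_eq ?_; funext x y; exact Category.assoc _ _ _)

/-! ### The biproduct of lax categories -/

variable [RelatorInvolution V]

/-- The biproduct of lax categories. -/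
abbrev LaxCat.tensor (X : LaxCat.{w} V) (T : LaxCat.{w'} V) : LaxCat.{max w w'} V where
  toVGraph := X.toVGraph.tensor T.toVGraph
  isLax :=
    { one_comp := fun x y => by
        refine sim_iff.2 ?_
        simp only [VGraph.tensor, q_comp, q_whiskerRight, q_m, q_tensor]
        refine (tensor_one_comp (q (X.one x.1)) (q (T.one x.2)) (q (X.comp x.1 x.1 y.1))
          (q (T.comp x.2 x.2 y.2))).trans ?_
        have h1 := X.isLax.bar.one_comp x.1 y.1
        have h2 := T.isLax.bar.one_comp x.2 y.2
        exact (congrArg₂ (fun f g => f ⊗ₘ g) h1 h2).trans (id_tensorHom_id _ _)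
      comp_one := fun x y => by
        refine sim_iff.2 ?_
        simp only [VGraph.tensor, q_comp, q_whiskerLeft, q_m, q_tensor]
        refine (tensor_comp_one (q (X.one y.1)) (q (T.one y.2)) (q (X.comp x.1 y.1 y.1))
          (q (T.comp x.2 y.2 y.2))).trans ?_
        have h1 := X.isLax.bar.comp_one x.1 y.1
        have h2 := T.isLax.bar.comp_one x.2 y.2
        exact (congrArg₂ (fun f g => f ⊗ₘ g) h1 h2).trans (id_tensorHom_id _ _)
      assoc := fun x y z a => by
        refine sim_iff.2 ?_
        simp only [VGraph.tensor, q_comp, q_whiskerLeft, q_whiskerRight, q_m, q_tensor]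
        exact tensor_assoc _ _ _ _ _ _ _ _ (X.isLax.bar.assoc x.1 y.1 z.1 a.1)
          (T.isLax.bar.assoc x.2 y.2 z.2 a.2) }

/-- The biproduct `f ⊗ Id_T` as a laxly natural functor. -/
abbrev LaxFun.tensorId {X : LaxCat.{w} V} {Y : LaxCat.{w'} V} (f : LaxFun X Y)
    (T : LaxCat.{w''} V) : LaxFun (X.tensor T) (Y.tensor T) where
  toTransport := f.toTransport.tensorId T.toVGraph
  isLaxNatural :=
    { map_one := fun x => by
        refine sim_iff.2 ?_
        simp only [LaxCat.tensor, VGraph.tensor, Transport.tensorId, q_comp, q_whiskerRight,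
          q_tensor, Category.assoc]
        rw [← f.q_map_one x.1, ← tensorHom_id, tensorHom_comp_tensorHom, Category.comp_id]
      map_comp := fun x y z => by
        refine sim_iff.2 ?_
        simp only [LaxCat.tensor, VGraph.tensor, Transport.tensorId, q_comp, q_whiskerRight,
          q_tensor, Category.assoc, q_m]
        have h := tensorμ_natural (q (f.map x.1 y.1)) (𝟙 (Bar.mk (T.Hom x.2 y.2)))
          (q (f.map y.1 z.1)) (𝟙 (Bar.mk (T.Hom y.2 z.2)))
        simp only [tensorHom_id] at h
        rw [reassoc_of% h]
        congr 1
        rw [← tensorHom_id, ← tensorHom_id, tensorHom_comp_tensorHom, tensorHom_comp_tensorHom,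
          Category.comp_id, f.q_map_comp]
        simp only [cc, tensorHom_id, id_whiskerRight, Category.id_comp] }

end Lax
end VLax
namespace VLax

section Lexp

variable {V : Type u} [Category.{v} V] [MonoidalCategory V] [OrderedMonoidal V]
  [∀ s : V, (tensorRight s).IsLeftAdjoint]

theorem comp_nameEquiv {r r' s k : V} (h : r' ⟶ r) (f : r ⊗ s ⟶ k) :
    h ≫ nameEquiv r s k f = nameEquiv r' s k (h ▷ s ≫ f) :=
  ((Adjunction.ofIsLeftAdjoint (tensorRight s)).homEquiv_naturality_left h f).symm

theorem sim_of_nameEquiv {r s k : V} {f g : r ⊗ s ⟶ k}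
    (h : nameEquiv r s k f ∼ nameEquiv r s k g) : f ∼ g := by
  have e : ∀ a : r ⟶ power k s, (nameEquiv r s k).symm a =
      a ▷ s ≫ (Adjunction.ofIsLeftAdjoint (tensorRight s)).counit.app k := fun a =>
    Adjunction.homEquiv_counit _ _ _ a
  rw [← (nameEquiv r s k).symm_apply_apply f, ← (nameEquiv r s k).symm_apply_apply g, e, e]
  exact (h.whiskerRight s).comp (Sim.refl _)

variable [HasProducts.{t} V] [ValuesComplete.{t} V]

theorem sim_of_proj {J : Type t} {p : J → V} {r : V} {f g : r ⟶ ∏ᶜ p}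
    (h : ∀ j, f ≫ Pi.π p j ∼ g ≫ Pi.π p j) : f ∼ g :=
  ⟨ValuesComplete.le_of_proj p f g fun j => (h j).1,
    ValuesComplete.le_of_proj p g f fun j => (h j).2⟩

theorem sim_of_component {Y : VGraph.{w} V} {T : VGraph.{t} V} {φ ψ : Transport T Y} {r : V}
    {f g : r ⟶ transforms φ ψ} (h : ∀ s, f ≫ component φ ψ s ∼ g ≫ component φ ψ s) : f ∼ g :=
  sim_of_proj h

variable [RelatorInvolution V]

/-- The names of the precontact arrows, collected over all pairs of vertexes of `T`. -/
def preName {Y : VGraph.{w} V} {T : VGraph.{t} V} (φ ψ : Transport T Y) :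
    transforms φ ψ ⟶
      ∏ᶜ fun p : T.Obj × T.Obj => power (Y.Hom (φ.obj p.1) (ψ.obj p.2)) (T.Hom p.1 p.2) :=
  Pi.lift fun p => nameEquiv _ _ _ (precontact φ ψ p.1 p.2)

/-- The names of the postcontact arrows, collected over all pairs of vertexes of `T`. -/
def postName {Y : VGraph.{w} V} {T : VGraph.{t} V} (φ ψ : Transport T Y) :
    transforms φ ψ ⟶
      ∏ᶜ fun p : T.Obj × T.Obj => power (Y.Hom (φ.obj p.1) (ψ.obj p.2)) (T.Hom p.1 p.2) :=
  Pi.lift fun p => nameEquiv _ _ _ (postcontact φ ψ p.1 p.2)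

/-- The object of laxly natural transforms from `φ` to `ψ`: the inverse image, in the object of all
transforms, of the similarity relation between the names of pre- and postcontact arrows. -/
def laxTransforms {Y : VGraph.{w} V} {T : VGraph.{t} V} (φ ψ : Transport T Y) :
    SimInverseImage (preName φ ψ) (postName φ ψ) :=
  (ValuesComplete.inverseImage.{t} _ _).some

theorem isNat_iff {Y : VGraph.{w} V} {T : VGraph.{t} V} {φ ψ : Transport T Y} {r : V}
    (h : r ⟶ transforms φ ψ) :
    h ≫ preName φ ψ ∼ h ≫ postName φ ψ ↔
      ∀ s s' : T.Obj, h ▷ T.Hom s s' ≫ precontact φ ψ s s' ∼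
        h ▷ T.Hom s s' ≫ postcontact φ ψ s s' := by
  constructor
  · intro H s s'
    have H' := H.comp (Sim.refl (Pi.π _ (s, s')))
    simp only [preName, postName, Category.assoc, Pi.lift_π] at H'
    refine sim_of_nameEquiv ?_
    rw [← comp_nameEquiv, ← comp_nameEquiv]
    exact H'
  · intro H
    refine sim_of_proj fun p => ?_
    simp only [preName, postName, Category.assoc, Pi.lift_π]
    have H' := ValuesComplete.name_sim.{t} (H p.1 p.2)
    rw [← comp_nameEquiv, ← comp_nameEquiv] at H'
    exact H'

theorem q_precontact {Y : VGraph.{w} V} {T : VGraph.{t} V} {φ ψ : Transport T Y} {r : V}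
    (h : r ⟶ transforms φ ψ) (s s' : T.Obj) :
    q (h ▷ T.Hom s s' ≫ precontact φ ψ s s') =
      cc (Y := Y.bar) (q (h ≫ component φ ψ s)) (q (ψ.map s s')) := by
  rw [precontact, ← tensorHom_id, tensorHom_comp_tensorHom_assoc, Category.id_comp]
  rfl

theorem q_postcontact {Y : VGraph.{w} V} {T : VGraph.{t} V} {φ ψ : Transport T Y} {r : V}
    (h : r ⟶ transforms φ ψ) (s s' : T.Obj) :
    q (h ▷ T.Hom s s' ≫ postcontact φ ψ s s') =
      (β_ (Bar.mk r) (Bar.mk (T.Hom s s'))).hom ≫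
        cc (Y := Y.bar) (q (φ.map s s')) (q (h ≫ component φ ψ s')) := by
  rw [postcontact, q_comp, q_comp, q_whiskerRight, q_swap, ← tensorHom_id,
    BraidedCategory.braiding_naturality_assoc]
  congr 1
  rw [q_comp, q_tensor, tensorHom_comp_tensorHom_assoc, Category.id_comp]
  rfl

theorem isNat_iff' {Y : VGraph.{w} V} {T : VGraph.{t} V} {φ ψ : Transport T Y} {r : V}
    (h : r ⟶ transforms φ ψ) :
    h ≫ preName φ ψ ∼ h ≫ postName φ ψ ↔
      ∀ s s' : T.Obj, cc (Y := Y.bar) (q (h ≫ component φ ψ s)) (q (ψ.map s s')) =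
        (β_ (Bar.mk r) (Bar.mk (T.Hom s s'))).hom ≫
          cc (Y := Y.bar) (q (φ.map s s')) (q (h ≫ component φ ψ s')) := by
  rw [isNat_iff]
  simp only [sim_iff, q_precontact, q_postcontact]

/-- The component of laxly natural transforms at a vertex `s`. -/
def laxComponent {Y : VGraph.{w} V} {T : VGraph.{t} V} (φ ψ : Transport T Y) (s : T.Obj) :
    (laxTransforms φ ψ).obj ⟶ Y.Hom (φ.obj s) (ψ.obj s) :=
  (laxTransforms φ ψ).ι ≫ component φ ψ s

theorem laxComponent_nat {Y : VGraph.{w} V} {T : VGraph.{t} V} (φ ψ : Transport T Y)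
    (s s' : T.Obj) : cc (Y := Y.bar) (q (laxComponent φ ψ s)) (q (ψ.map s s')) =
        (β_ _ (Bar.mk (T.Hom s s'))).hom ≫
          cc (Y := Y.bar) (q (φ.map s s')) (q (laxComponent φ ψ s')) :=
  (isNat_iff' _).1 (laxTransforms φ ψ).condition s s'

theorem sim_of_laxComponent {Y : VGraph.{w} V} {T : VGraph.{t} V} {φ ψ : Transport T Y} {r : V}
    {h k : r ⟶ (laxTransforms φ ψ).obj}
    (w : ∀ s, h ≫ laxComponent φ ψ s ∼ k ≫ laxComponent φ ψ s) : h ∼ k := by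
  have e : h ≫ (laxTransforms φ ψ).ι ∼ k ≫ (laxTransforms φ ψ).ι :=
    sim_of_component fun s => by rw [Category.assoc, Category.assoc]; exact w s
  exact ⟨(laxTransforms _ _).le_of_le _ _ e.1, (laxTransforms _ _).le_of_le _ _ e.2⟩

theorem ext_of_laxComponent {Y : VGraph.{w} V} {T : VGraph.{t} V} {φ ψ : Transport T Y} {r : V}
    {h k : r ⟶ (laxTransforms φ ψ).obj}
    (w : ∀ s, h ≫ laxComponent φ ψ s = k ≫ laxComponent φ ψ s) : h = k :=
  (laxTransforms φ ψ).hom_ext _ _ (transforms_ext fun s => by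
    rw [Category.assoc, Category.assoc]; exact w s)

/-- Auxiliary: lax naturality of a family of components, in the quotient category. -/
def IsNat {Y : VGraph.{w} V} {T : VGraph.{t} V} {φ ψ : Transport T Y} {r : V}
    (h : ∀ s, r ⟶ Y.Hom (φ.obj s) (ψ.obj s)) : Prop :=
  ∀ s s' : T.Obj, cc (Y := Y.bar) (q (h s)) (q (ψ.map s s')) =
    (β_ (Bar.mk r) (Bar.mk (T.Hom s s'))).hom ≫ cc (Y := Y.bar) (q (φ.map s s')) (q (h s'))

/-- The arrow to the object of laxly natural transforms with given components. -/
def liftLax {Y : VGraph.{w} V} {T : VGraph.{t} V} {φ ψ : Transport T Y} {r : V}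
    (h : ∀ s, r ⟶ Y.Hom (φ.obj s) (ψ.obj s)) (H : IsNat h) : r ⟶ (laxTransforms φ ψ).obj :=
  (laxTransforms φ ψ).lift (liftTransforms h) ((isNat_iff' _).2 fun s s' => by
    rw [lift_component, lift_component]; exact H s s')

theorem liftLax_ι {Y : VGraph.{w} V} {T : VGraph.{t} V} {φ ψ : Transport T Y} {r : V}
    (h : ∀ s, r ⟶ Y.Hom (φ.obj s) (ψ.obj s)) (H) :
    liftLax h H ≫ (laxTransforms φ ψ).ι = liftTransforms h :=
  SimInverseImage.lift_ι _ _ _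

@[simp]
theorem liftLax_component {Y : VGraph.{w} V} {T : VGraph.{t} V} {φ ψ : Transport T Y} {r : V}
    (h : ∀ s, r ⟶ Y.Hom (φ.obj s) (ψ.obj s)) (H) (s : T.Obj) :
    liftLax h H ≫ laxComponent φ ψ s = h s := by
  rw [laxComponent, ← Category.assoc, liftLax_ι, lift_component]

/-- The unit laxly natural transform. -/
def laxOne {Y : LaxCat.{w} V} {T : LaxCat.{t} V} (φ : LaxFun T Y) :
    𝟙_ V ⟶ (laxTransforms φ.toTransport φ.toTransport).obj :=
  liftLax (fun s => Y.one (φ.obj s)) (fun s s' => by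
      refine (Y.isLax.bar.one_comp' _).trans ?_
      refine Eq.trans ?_ (congrArg (fun k => (β_ (𝟙_ (Bar V)) _).hom ≫ k)
        (Y.isLax.bar.comp_one' (q (φ.map s s'))).symm)
      exact (braiding_rightUnitor_assoc _ _).symm)

/-- The contact arrows of laxly natural transforms: composition in every component. -/
def laxComp {Y : LaxCat.{w} V} {T : LaxCat.{t} V} (φ ψ ξ : LaxFun T Y) :
    (laxTransforms φ.toTransport ψ.toTransport).obj ⊗
      (laxTransforms ψ.toTransport ξ.toTransport).obj ⟶
        (laxTransforms φ.toTransport ξ.toTransport).obj :=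
  liftLax (fun s =>
      (laxComponent φ.toTransport ψ.toTransport s ⊗ₘ laxComponent ψ.toTransport ξ.toTransport s) ≫
        Y.comp (φ.obj s) (ψ.obj s) (ξ.obj s)) (fun s s' =>
      Y.isLax.bar.natural_comp _ _ _ _ _ _ _ (laxComponent_nat _ _ s s')
        (laxComponent_nat _ _ s s'))

theorem laxOne_component {Y : LaxCat.{w} V} {T : LaxCat.{t} V} (φ : LaxFun T Y) (s : T.Obj) :
    laxOne φ ≫ laxComponent φ.toTransport φ.toTransport s = Y.one (φ.obj s) :=
  liftLax_component _ _ _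

theorem laxComp_component {Y : LaxCat.{w} V} {T : LaxCat.{t} V} (φ ψ ξ : LaxFun T Y)
    (s : T.Obj) : laxComp φ ψ ξ ≫ laxComponent φ.toTransport ξ.toTransport s =
      (laxComponent φ.toTransport ψ.toTransport s ⊗ₘ laxComponent ψ.toTransport ξ.toTransport s) ≫
        Y.comp (φ.obj s) (ψ.obj s) (ξ.obj s) :=
  liftLax_component _ _ _

theorem lax_one_comp {Y : LaxCat.{w} V} {T : LaxCat.{t} V} (φ ψ : LaxFun T Y) :
    (λ_ _).inv ≫ laxOne φ ▷ _ ≫ laxComp φ φ ψ ∼ 𝟙 _ := sim_of_laxComponent fun s => by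
  have h := (Y.isLax.bar.one_comp' (q (laxComponent φ.toTransport ψ.toTransport s)))
  rw [Category.assoc, Category.assoc, laxComp_component,
    ← tensorHom_id, tensorHom_comp_tensorHom_assoc, laxOne_component, Category.id_comp,
    sim_iff]
  refine (congrArg (fun k => q (λ_ _).inv ≫ k) h).trans ?_
  exact (qIso (λ_ _)).inv_hom_id_assoc _

theorem lax_comp_one {Y : LaxCat.{w} V} {T : LaxCat.{t} V} (φ ψ : LaxFun T Y) :
    (ρ_ _).inv ≫ _ ◁ laxOne ψ ≫ laxComp φ ψ ψ ∼ 𝟙 _ := sim_of_laxComponent fun s => by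
  have h := (Y.isLax.bar.comp_one' (q (laxComponent φ.toTransport ψ.toTransport s)))
  rw [Category.assoc, Category.assoc, laxComp_component,
    ← id_tensorHom, tensorHom_comp_tensorHom_assoc, laxOne_component, Category.id_comp,
    sim_iff]
  refine (congrArg (fun k => q (ρ_ _).inv ≫ k) h).trans ?_
  exact (qIso (ρ_ _)).inv_hom_id_assoc _

theorem lax_assoc {Y : LaxCat.{w} V} {T : LaxCat.{t} V} (φ ψ ξ ζ : LaxFun T Y) :
    (α_ _ _ _).hom ≫ _ ◁ laxComp ψ ξ ζ ≫ laxComp φ ψ ζ ∼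
      laxComp φ ψ ξ ▷ _ ≫ laxComp φ ξ ζ := sim_of_laxComponent fun s => by
  have h := Y.isLax.bar.cc_assoc (q (laxComponent φ.toTransport ψ.toTransport s))
    (q (laxComponent ψ.toTransport ξ.toTransport s))
    (q (laxComponent ξ.toTransport ζ.toTransport s))
  rw [Category.assoc, Category.assoc, Category.assoc, laxComp_component, laxComp_component,
    ← tensorHom_id, ← id_tensorHom,
    tensorHom_comp_tensorHom_assoc, tensorHom_comp_tensorHom_assoc, laxComp_component,
    laxComp_component, Category.id_comp, Category.id_comp, sim_iff]
  exact h.symm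

/-- The exponential space `Y^(T)` of laxly natural transforms between laxly natural functors. -/
abbrev LaxCat.lexp (Y : LaxCat.{w} V) (T : LaxCat.{t} V) : LaxCat.{max t v w} V where
  Obj := LaxFun T Y
  Hom φ ψ := (laxTransforms φ.toTransport ψ.toTransport).obj
  one φ := laxOne φ
  comp φ ψ ξ := laxComp φ ψ ξ
  isLax :=
    { one_comp := fun φ ψ => lax_one_comp φ ψ
      comp_one := fun φ ψ => lax_comp_one φ ψ
      assoc := fun φ ψ ξ ζ => lax_assoc φ ψ ξ ζ }

/-- The imbedding of the exponential space of laxly natural transforms into the exponential space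
of all transforms. -/
abbrev LaxCat.incl (Y : LaxCat.{w} V) (T : LaxCat.{t} V) :
    Transport (Y.lexp T).toVGraph (Y.toVGraph.exp T.toVGraph) where
  obj φ := φ.toTransport
  map φ ψ := (laxTransforms φ.toTransport ψ.toTransport).ι

theorem IsNat.map {X : LaxCat.{w} V} {Y : LaxCat.{w'} V} (f : LaxFun X Y) {T : LaxCat.{t} V}
    {φ ψ : Transport T.toVGraph X.toVGraph} {r : V} {h : ∀ s, r ⟶ X.Hom (φ.obj s) (ψ.obj s)}
    (H : IsNat h) : IsNat (φ := φ.comp f.toTransport) (ψ := ψ.comp f.toTransport)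
      (fun s => h s ≫ f.map (φ.obj s) (ψ.obj s)) := fun s s' => by
  have e : ∀ {A B : V} {x y z : X.Obj} (a : A ⟶ X.Hom x y) (b : B ⟶ X.Hom y z),
      cc (Y := Y.bar) (q (a ≫ f.map x y)) (q (b ≫ f.map y z)) =
        cc (Y := X.bar) (q a) (q b) ≫ q (f.map x z) := fun a b => by
    rw [q_comp, q_comp, cc_pre, ← f.q_map_comp]; simp [cc, VGraph.bar]
  refine (e _ _).trans ?_
  rw [H s s', Category.assoc, ← e]

theorem laxComponent_isNat {Y : VGraph.{w} V} {T : VGraph.{t} V} (φ ψ : Transport T Y) :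
    IsNat (laxComponent φ ψ) := laxComponent_nat φ ψ

/-- The mapping of laxly natural transforms by a laxly natural functor. -/
def laxMap {X : LaxCat.{w} V} {Y : LaxCat.{w'} V} (f : LaxFun X Y) {T : LaxCat.{t} V}
    (φ ψ : LaxFun T X) : (laxTransforms φ.toTransport ψ.toTransport).obj ⟶
      (laxTransforms (φ.comp f).toTransport (ψ.comp f).toTransport).obj :=
  liftLax _ ((laxComponent_isNat φ.toTransport ψ.toTransport).map f)

theorem laxMap_component {X : LaxCat.{w} V} {Y : LaxCat.{w'} V} (f : LaxFun X Y)
    {T : LaxCat.{t} V} (φ ψ : LaxFun T X) (s : T.Obj) :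
    laxMap f φ ψ ≫ laxComponent (φ.comp f).toTransport (ψ.comp f).toTransport s =
      laxComponent φ.toTransport ψ.toTransport s ≫ f.map (φ.obj s) (ψ.obj s) :=
  liftLax_component _ _ _

theorem lax_map_one {X : LaxCat.{w} V} {Y : LaxCat.{w'} V} (f : LaxFun X Y)
    {T : LaxCat.{t} V} (φ : LaxFun T X) :
    laxOne φ ≫ laxMap f φ φ ∼ laxOne (φ.comp f) := sim_of_laxComponent fun s => by
  rw [Category.assoc, laxMap_component, reassoc_of% laxOne_component, laxOne_component]
  exact f.isLaxNatural.map_one _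

theorem lax_map_comp {X : LaxCat.{w} V} {Y : LaxCat.{w'} V} (f : LaxFun X Y)
    {T : LaxCat.{t} V} (φ ψ ξ : LaxFun T X) :
    laxComp φ ψ ξ ≫ laxMap f φ ξ ∼
      (laxMap f φ ψ ⊗ₘ laxMap f ψ ξ) ≫ laxComp (φ.comp f) (ψ.comp f) (ξ.comp f) :=
  sim_of_laxComponent fun s => by
  rw [Category.assoc, Category.assoc, laxMap_component, reassoc_of% laxComp_component,
    laxComp_component, tensorHom_comp_tensorHom_assoc, laxMap_component, laxMap_component,
    ← tensorHom_comp_tensorHom, Category.assoc]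
  exact (Sim.refl _).comp (f.isLaxNatural.map_comp _ _ _)

/-- The changing of target space `f^(T) : X^(T) → Y^(T)`. -/
def LaxFun.lexp {X : LaxCat.{w} V} {Y : LaxCat.{w'} V} (f : LaxFun X Y)
    (T : LaxCat.{t} V) : LaxFun (X.lexp T) (Y.lexp T) where
  obj φ := LaxFun.comp φ f
  map φ ψ := laxMap f φ ψ
  isLaxNatural :=
    { map_one := fun φ => lax_map_one f φ
      map_comp := fun φ ψ ξ => lax_map_comp f φ ψ ξ }

theorem sec_isLaxNatural (X : LaxCat.{w} V) (T : LaxCat.{t} V) (a : X.Obj) :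
    ((X.toVGraph.sections T.toVGraph).obj a).IsLaxNatural where
  map_one s := by
    simp only [leftUnitor_inv_naturality_assoc, ← id_tensorHom, ← tensorHom_id,
      tensorHom_comp_tensorHom, Category.id_comp, Category.comp_id]
    exact Sim.refl _
  map_comp s s' s'' := by
    rw [sim_iff]
    simp only [q_comp, q_tensor, q_m, q_whiskerRight]
    have h1 := X.isLax.bar.one_comp' (X.bar.one a)
    have h := tensor_sec (q (X.one a)) (q (X.one a)) (q (X.one a)) (q (X.comp a a a))
      (q (T.comp s s' s'')) h1
    exact h.symm

/-- The section at a vertex `a`. -/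
abbrev LaxCat.sec (X : LaxCat.{w} V) (T : LaxCat.{t} V) (a : X.Obj) : LaxFun T (X.tensor T) where
  toTransport := (X.toVGraph.sections T.toVGraph).obj a
  isLaxNatural := sec_isLaxNatural X T a

theorem lam_isNat (X : LaxCat.{w} V) (T : LaxCat.{t} V) (a b : X.Obj) :
    IsNat (φ := (X.sec T a).toTransport) (ψ := (X.sec T b).toTransport)
      (fun s => (ρ_ (X.Hom a b)).inv ≫ X.Hom a b ◁ T.one s) := fun s s' => by
  have h1 := tensor_pre (q (T.one s)) (q (X.one b)) (q (X.comp a b b)) (q (T.comp s s s'))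
  have h2 := tensor_post (q (X.one a)) (q (T.one s')) (q (X.comp a a b)) (q (T.comp s s' s'))
  have e1 := X.isLax.bar.one_comp a b
  have e2 := X.isLax.bar.comp_one a b
  have e3 := T.isLax.bar.one_comp s s'
  have e4 := T.isLax.bar.comp_one s s'
  have h : cc (Y := (X.tensor T).bar) (x := (a, s)) (y := (b, s)) (z := (b, s'))
      (q ((ρ_ (X.Hom a b)).inv ≫ X.Hom a b ◁ T.one s))
      (q ((λ_ (T.Hom s s')).inv ≫ X.one b ▷ T.Hom s s')) = 𝟙 _ := by
    refine Eq.trans ?_ (h1.trans ?_)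
    · rw [← q_m]; rfl
    · exact (congrArg₂ (fun f g => f ⊗ₘ g) e2 e3).trans (id_tensorHom_id _ _)
  have h' : (β_ _ _).hom ≫ cc (Y := (X.tensor T).bar) (x := (a, s)) (y := (a, s')) (z := (b, s'))
      (q ((λ_ (T.Hom s s')).inv ≫ X.one a ▷ T.Hom s s'))
      (q ((ρ_ (X.Hom a b)).inv ≫ X.Hom a b ◁ T.one s')) = 𝟙 _ := by
    refine Eq.trans ?_ (h2.trans ?_)
    · rw [← q_m]; rfl
    · exact (congrArg₂ (fun f g => f ⊗ₘ g) e1 e4).trans (id_tensorHom_id _ _)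
  exact h.trans h'.symm

/-- The arrow to the laxly natural transforms between sections. -/
def lamMap (X : LaxCat.{w} V) (T : LaxCat.{t} V) (a b : X.Obj) : X.Hom a b ⟶
    (laxTransforms (X.sec T a).toTransport (X.sec T b).toTransport).obj :=
  liftLax _ (lam_isNat X T a b)

theorem lamMap_component (X : LaxCat.{w} V) (T : LaxCat.{t} V) (a b : X.Obj) (s : T.Obj) :
    lamMap X T a b ≫ laxComponent (X.sec T a).toTransport (X.sec T b).toTransport s =
      (ρ_ (X.Hom a b)).inv ≫ X.Hom a b ◁ T.one s :=
  liftLax_component _ _ _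

theorem lamMap_one (X : LaxCat.{w} V) (T : LaxCat.{t} V) (a : X.Obj) :
    X.one a ≫ lamMap X T a a ∼ laxOne (X.sec T a) := sim_of_laxComponent fun s => by
  rw [Category.assoc, lamMap_component, laxOne_component]
  simp only [rightUnitor_inv_naturality_assoc, ← id_tensorHom, ← tensorHom_id,
      tensorHom_comp_tensorHom, Category.id_comp, Category.comp_id, unitors_inv_equal]
  exact Sim.refl _

theorem lamMap_comp (X : LaxCat.{w} V) (T : LaxCat.{t} V) (a b c : X.Obj) :
    X.comp a b c ≫ lamMap X T a c ∼ (lamMap X T a b ⊗ₘ lamMap X T b c) ≫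
      laxComp (X.sec T a) (X.sec T b) (X.sec T c) := sim_of_laxComponent fun s => by
  rw [Category.assoc, Category.assoc, lamMap_component, laxComp_component,
    tensorHom_comp_tensorHom_assoc, lamMap_component, lamMap_component, sim_iff]
  simp only [q_comp, q_tensor, q_m, q_whiskerLeft]
  have h1 := T.isLax.bar.one_comp' (T.bar.one s)
  exact (tensor_lam (q (T.one s)) (q (T.one s)) (q (T.one s)) (q (X.comp a b c))
    (q (T.comp s s s)) h1).symm

/-- The sections functor `λ_X : X → (X ⊗ T)^(T)`. -/
abbrev LaxCat.lam (X : LaxCat.{w} V) (T : LaxCat.{t} V) :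
    LaxFun X ((X.tensor T).lexp T) where
  obj a := X.sec T a
  map a b := lamMap X T a b
  isLaxNatural :=
    { map_one := fun a => lamMap_one X T a
      map_comp := fun a b c => lamMap_comp X T a b c }

/-- The mappings of the preevaluation. -/
def evMap {Y : LaxCat.{w} V} {T : LaxCat.{t} V} (φ ψ : LaxFun T Y) (s s' : T.Obj) :
    (laxTransforms φ.toTransport ψ.toTransport).obj ⊗ T.Hom s s' ⟶ Y.Hom (φ.obj s) (ψ.obj s') :=
  (laxTransforms φ.toTransport ψ.toTransport).ι ▷ T.Hom s s' ≫
    precontact φ.toTransport ψ.toTransport s s'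

/-- The mappings of the postevaluation. -/
def evMap' {Y : LaxCat.{w} V} {T : LaxCat.{t} V} (φ ψ : LaxFun T Y) (s s' : T.Obj) :
    (laxTransforms φ.toTransport ψ.toTransport).obj ⊗ T.Hom s s' ⟶ Y.Hom (φ.obj s) (ψ.obj s') :=
  (laxTransforms φ.toTransport ψ.toTransport).ι ▷ T.Hom s s' ≫
    postcontact φ.toTransport ψ.toTransport s s'

theorem evMap_sim {Y : LaxCat.{w} V} {T : LaxCat.{t} V} (φ ψ : LaxFun T Y) (s s' : T.Obj) :
    evMap φ ψ s s' ∼ evMap' φ ψ s s' :=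
  (isNat_iff _).1 (laxTransforms φ.toTransport ψ.toTransport).condition s s'

theorem q_evMap {Y : LaxCat.{w} V} {T : LaxCat.{t} V} (φ ψ : LaxFun T Y) (s s' : T.Obj) :
    q (evMap φ ψ s s') = cc (Y := Y.bar) (q (laxComponent φ.toTransport ψ.toTransport s))
      (q (ψ.map s s')) :=
  q_precontact _ _ _

theorem evMap_one {Y : LaxCat.{w} V} {T : LaxCat.{t} V} (φ : LaxFun T Y) (s : T.Obj) :
    ((λ_ (𝟙_ V)).inv ≫ (laxOne φ ⊗ₘ T.one s)) ≫ evMap φ φ s s ∼ Y.one (φ.obj s) := by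
  rw [sim_iff, q_comp, q_evMap, q_comp, q_tensor, Category.assoc, ← cc_pre, ← q_comp,
    laxOne_component, φ.q_map_one]
  refine (congrArg (fun k => q (λ_ (𝟙_ V)).inv ≫ k)
    (Y.isLax.bar.one_comp' (Y.bar.one (φ.obj s)))).trans ?_
  exact (qIso (λ_ (𝟙_ V))).inv_hom_id_assoc _

theorem evMap_comp {Y : LaxCat.{w} V} {T : LaxCat.{t} V} (φ ψ ξ : LaxFun T Y)
    (s s' s'' : T.Obj) :
    (RelatorInvolution.m _ _ _ _ ≫ (laxComp φ ψ ξ ⊗ₘ T.comp s s' s'')) ≫ evMap φ ξ s s'' ∼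
      (evMap φ ψ s s' ⊗ₘ evMap ψ ξ s' s'') ≫ Y.comp (φ.obj s) (ψ.obj s') (ξ.obj s'') := by
  rw [sim_iff, q_comp, q_evMap, q_comp, q_tensor, Category.assoc, ← cc_pre, ← q_comp,
    laxComp_component, ξ.q_map_comp, q_m, q_comp, q_tensor,
    q_comp (evMap φ ψ s s' ⊗ₘ _), q_tensor, q_evMap, q_evMap]
  exact Y.isLax.bar.preEval_comp _ _ _ _ _ _ (laxComponent_nat _ _ s s')

/-- The preevaluation functor `ev⁺ : Y^(T) ⊗ T → Y`. -/
abbrev LaxCat.evPlus (Y : LaxCat.{w} V) (T : LaxCat.{t} V) :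
    LaxFun ((Y.lexp T).tensor T) Y where
  toTransport := ((Y.incl T).tensorId T.toVGraph).comp (Y.toVGraph.preEval T.toVGraph)
  isLaxNatural :=
    { map_one := fun a => evMap_one a.1 a.2
      map_comp := fun a b c => evMap_comp a.1 b.1 c.1 a.2 b.2 c.2 }

/-- The postevaluation functor `ev⁻ : Y^(T) ⊗ T → Y`. -/
abbrev LaxCat.evMinus (Y : LaxCat.{w} V) (T : LaxCat.{t} V) :
    LaxFun ((Y.lexp T).tensor T) Y where
  toTransport := ((Y.incl T).tensorId T.toVGraph).comp (Y.toVGraph.postEval T.toVGraph)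
  isLaxNatural :=
    { map_one := fun a => ((Sim.refl _).comp (evMap_sim _ _ _ _).symm).trans (evMap_one a.1 a.2)
      map_comp := fun a b c => (((Sim.refl _).comp (evMap_sim _ _ _ _).symm).trans
        (evMap_comp a.1 b.1 c.1 a.2 b.2 c.2)).trans
          (((evMap_sim _ _ _ _).tensor (evMap_sim _ _ _ _)).comp (Sim.refl _)) }

variable (V) in
/-- The superfunctor `- ⊗ T`. -/
abbrev tensorFunctor (T : LaxCat.{t} V) : LaxCat.{max t v w} V ⥤ LaxCat.{max t v w} V where
  obj X := X.tensor T
  map f := LaxFun.tensorId f T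
  map_id X := LaxFun.ext rfl (by
    refine heq_of_eq ?_; funext x y; exact id_whiskerRight _ _)
  map_comp f g := LaxFun.ext rfl (by
    refine heq_of_eq ?_; funext x y; exact comp_whiskerRight _ _ _)

theorem lexp_ext {X : LaxCat.{w} V} {Y : LaxCat.{w'} V} {T : LaxCat.{t} V}
    {f g : LaxFun X (Y.lexp T)} (h : ∀ a, f.obj a = g.obj a)
    (e : ∀ a b s, HEq (f.map a b ≫ laxComponent (f.obj a).toTransport (f.obj b).toTransport s)
      (g.map a b ≫ laxComponent (g.obj a).toTransport (g.obj b).toTransport s)) : f = g := by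
  obtain ⟨⟨fo, fm⟩, hf⟩ := f
  obtain ⟨⟨go, gm⟩, hg⟩ := g
  obtain rfl : fo = go := funext h
  refine LaxFun.ext rfl (heq_of_eq ?_)
  funext a b
  exact ext_of_laxComponent fun s => eq_of_heq (e a b s)

variable (V) in
/-- The superfunctor `(-)^(T)`. -/
abbrev lexpFunctor (T : LaxCat.{t} V) : LaxCat.{max t v w} V ⥤ LaxCat.{max t v w} V where
  obj Y := Y.lexp T
  map f := LaxFun.lexp f T
  map_id X := lexp_ext (fun φ => LaxFun.comp_id φ) fun φ ψ s =>
    heq_of_eq ((laxMap_component (LaxFun.id X) φ ψ s).trans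
      ((Category.comp_id _).trans (Category.id_comp _).symm))
  map_comp {X Y Z} f g := lexp_ext (fun φ => (LaxFun.comp_assoc φ f g).symm) fun φ ψ s => by
    refine heq_of_eq ((laxMap_component (LaxFun.comp f g) φ ψ s).trans (Eq.trans ?_
      (Category.assoc _ _ _).symm))
    refine Eq.trans ?_ (congrArg (fun k => laxMap f φ ψ ≫ k)
      (laxMap_component g (φ.comp f) (ψ.comp f) s)).symm
    exact (reassoc_of% (laxMap_component f φ ψ s)) _ |>.symm

end Lexp
end VLax
namespace VLax

section Forms

variable {V : Type u} [Category.{v} V] [MonoidalCategory V] [OrderedMonoidal V]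

/-- The order between laxly natural functors. -/
abbrev LaxFun.LE {X : LaxCat.{w} V} {Y : LaxCat.{w'} V} (f g : LaxFun X Y) : Prop :=
  f.toTransport.LE g.toTransport

/-- Equality of laxly natural functors up to canonical isomorphism. -/
abbrev LaxFun.Sim {X : LaxCat.{w} V} {Y : LaxCat.{w'} V} (f g : LaxFun X Y) : Prop :=
  f.toTransport.Sim g.toTransport

variable [∀ s : V, (tensorRight s).IsLeftAdjoint] [HasProducts.{t} V] [ValuesComplete.{t} V]
  [RelatorInvolution V] {X : LaxCat.{w} V} {Y : LaxCat.{w'} V} {T : LaxCat.{t} V}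

/-- The secondary order between laxly natural functors to an exponential space. -/
abbrev LaxFun.SecLE (g g' : LaxFun X (Y.lexp T)) : Prop :=
  (g.toTransport.comp (Y.incl T)).SecLE (g'.toTransport.comp (Y.incl T))

/-- Equality up to canonical isomorphism of laxly natural functors to an exponential space. -/
abbrev LaxFun.SecSim (g g' : LaxFun X (Y.lexp T)) : Prop :=
  (g.toTransport.comp (Y.incl T)).SecSim (g'.toTransport.comp (Y.incl T))

/-- The name of a laxly natural form. -/
abbrev LaxFun.name (f : LaxFun (X.tensor T) Y) : LaxFun X (Y.lexp T) :=
  (X.lam T).comp (f.lexp T)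

/-- The prerealization of a laxly natural name form. -/
abbrev LaxFun.preReal (g : LaxFun X (Y.lexp T)) : LaxFun (X.tensor T) Y :=
  (g.tensorId T).comp (Y.evPlus T)

/-- The postrealization of a laxly natural name form. -/
abbrev LaxFun.postReal (g : LaxFun X (Y.lexp T)) : LaxFun (X.tensor T) Y :=
  (g.tensorId T).comp (Y.evMinus T)

end Forms
end VLax

end

open CategoryTheory MonoidalCategory Limits VLax

/-! Whatever holds only up to `∼` is computed in `Bar V`, whose arrows are `∼`-classes. There the
relator's involution becomes the middle interchange `tensorμ` of a symmetric monoidal category,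
`swap` becomes its braiding, and lax `V`-categories and laxly natural functors satisfy their laws as
equations. Products and inverse images are handled in `V` itself: an arrow into an object of
transforms, laxly natural or not, is determined by its components, both for equality and for `∼`.
Hence statements about composites with `J` can be strict equalities (`LaxFun.lexp_comp_incl`,
`LaxCat.lam_comp_incl`), and the secondary relations are checked after `J`, component by component.

The core is an adjunction between `- ⊗ T` and `(-)^(T)`, up to `∼`. The unit is natural because `f`
and `1_s` act on different tensor factors (`LaxFun.lam_naturality`); `ev⁺` is natural because a
functor preserves the composite of a component with a hom-arrow of the target functor
(`LaxFun.evPlus_naturality`). Both triangles come from unit laws: interchange turns `(X(a;b) ⊗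
1_s)(1_b ⊗ T(s;s'))` into the identity (`LaxCat.lam_evPlus`), and evaluating a transform against
units returns it (`LaxCat.lam_lexp_evPlus`). Since `ι` is the inverse image of `∼` for the pre- and
postcontact families, `ev⁺ ∼ ev⁻` holds by construction, and the statements on `ev⁻` follow from
those on `ev⁺`. Names and realizations are then mutually inverse by the usual adjunction
calculation.

For the factorization criterion, the hom-arrows of the two realizations of a name are the pre- and
postcontact arrows preceded by the name's hom-arrows. So `f⁺ ∼ f⁻` is exactly the condition under
which those hom-arrows lift through `ι` (`Transport.preReal_sim_postReal_of_comp_incl`,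
`Transport.exists_comp_incl_eq`). -/

noncomputable section

namespace VLax

/-! ### Order and similarity of parallel transports. -/

section ParallelTransports

variable {V : Type u} [Category.{v} V] [MonoidalCategory V] [OrderedMonoidal V]

theorem comp_eqToHom_le {p r r' : V} {e : r = r'} {f : p ⟶ r} {g : p ⟶ r'} :
    f ≫ eqToHom e ≤ g ↔ f ≤ g ≫ eqToHom e.symm := by
  subst e; simp

variable {X : VGraph.{w} V} {Y : VGraph.{w'} V} {Z : VGraph.{w''} V}

/-- With a common vertex map `o` the `eqToHom` in `LE` is an identity. Later proofs destructure
their transports and substitute the vertex maps to reach this case. -/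
theorem Transport.LE.of_map_le {o : X.Obj → Y.Obj} {m m' : ∀ x y, X.Hom x y ⟶ Y.Hom (o x) (o y)}
    (h : ∀ x y, m x y ≤ m' x y) : Transport.LE (X := X) (Y := Y) ⟨o, m⟩ ⟨o, m'⟩ :=
  ⟨fun _ => rfl, fun x y => by simpa using h x y⟩

theorem Transport.LE.map_le {o : X.Obj → Y.Obj} {m m' : ∀ x y, X.Hom x y ⟶ Y.Hom (o x) (o y)}
    (h : Transport.LE (X := X) (Y := Y) ⟨o, m⟩ ⟨o, m'⟩) (x y : X.Obj) : m x y ≤ m' x y := by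
  simpa using h.2 x y

theorem Transport.LE.obj_eq {f g : Transport X Y} (h : f.LE g) : f.obj = g.obj :=
  funext h.1

theorem Transport.LE.refl (f : Transport X Y) : f.LE f := .of_map_le fun _ _ => le_rfl

theorem Transport.LE.trans {f g h : Transport X Y} (h₁ : f.LE g) (h₂ : g.LE h) : f.LE h := by
  obtain ⟨fo, fm⟩ := f
  obtain ⟨go, gm⟩ := g
  obtain ⟨ho, hm⟩ := h
  obtain rfl : fo = go := h₁.obj_eq
  obtain rfl : fo = ho := h₂.obj_eq
  exact .of_map_le fun x y => (h₁.map_le x y).trans (h₂.map_le x y)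

theorem Transport.LE.comp {f f' : Transport X Y} {g g' : Transport Y Z} (hf : f.LE f')
    (hg : g.LE g') : (f.comp g).LE (f'.comp g') := by
  obtain ⟨fo, fm⟩ := f
  obtain ⟨fo', fm'⟩ := f'
  obtain ⟨go, gm⟩ := g
  obtain ⟨go', gm'⟩ := g'
  obtain rfl : fo = fo' := hf.obj_eq
  obtain rfl : go = go' := hg.obj_eq
  exact .of_map_le fun x y => OrderedMonoidal.comp_mono (hf.map_le x y) (hg.map_le _ _)

theorem Transport.Sim.refl (f : Transport X Y) : f.Sim f := ⟨.refl f, .refl f⟩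

theorem Transport.Sim.symm {f g : Transport X Y} (h : f.Sim g) : g.Sim f := ⟨h.2, h.1⟩

theorem Transport.Sim.trans {f g h : Transport X Y} (h₁ : f.Sim g) (h₂ : g.Sim h) : f.Sim h :=
  ⟨h₁.1.trans h₂.1, h₂.2.trans h₁.2⟩

theorem Transport.Sim.comp {f f' : Transport X Y} {g g' : Transport Y Z} (hf : f.Sim f')
    (hg : g.Sim g') : (f.comp g).Sim (f'.comp g') :=
  ⟨hf.1.comp hg.1, hf.2.comp hg.2⟩

theorem Transport.Sim.of_map_sim {o : X.Obj → Y.Obj}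
    {m m' : ∀ x y, X.Hom x y ⟶ Y.Hom (o x) (o y)} (h : ∀ x y, m x y ∼ m' x y) :
    Transport.Sim (X := X) (Y := Y) ⟨o, m⟩ ⟨o, m'⟩ :=
  ⟨.of_map_le fun x y => (h x y).1, .of_map_le fun x y => (h x y).2⟩

theorem Transport.Sim.map_sim {o : X.Obj → Y.Obj}
    {m m' : ∀ x y, X.Hom x y ⟶ Y.Hom (o x) (o y)}
    (h : Transport.Sim (X := X) (Y := Y) ⟨o, m⟩ ⟨o, m'⟩) (x y : X.Obj) : m x y ∼ m' x y :=
  ⟨h.1.map_le x y, h.2.map_le x y⟩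

/-- The two inequalities carry opposite `eqToHom`s; moving one across gives a single equation in
`Bar V`, where the monoidal calculations take place. -/
theorem Transport.sim_iff_q {f g : Transport X Y} : f.Sim g ↔
    ∃ h : ∀ x, f.obj x = g.obj x,
      ∀ x y, q (f.map x y ≫ eqToHom (by rw [h x, h y])) = q (g.map x y) := by
  constructor
  · rintro ⟨⟨h, h₁⟩, ⟨_, h₂⟩⟩
    exact ⟨h, fun x y => sim_iff.1 ⟨h₁ x y, comp_eqToHom_le.1 (h₂ x y)⟩⟩
  · rintro ⟨h, e⟩
    exact ⟨⟨h, fun x y => (sim_iff.2 (e x y)).1⟩,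
      ⟨fun x => (h x).symm, fun x y => comp_eqToHom_le.2 (sim_iff.2 (e x y)).2⟩⟩

/-- Whiskering is `⊗` with an identity. `OrderedMonoidal` only makes `⊗` respect `∼`, so a one-sided
inequality needs `hV`. -/
theorem Transport.LE.tensorId [RelatorInvolution V] (hV : MonotoneBiproduct V)
    {f g : Transport X Y} (h : f.LE g) (T : VGraph.{w''} V) :
    (f.tensorId T).LE (g.tensorId T) := by
  obtain ⟨fo, fm⟩ := f
  obtain ⟨go, gm⟩ := g
  obtain rfl : fo = go := h.obj_eq
  refine .of_map_le fun x y => ?_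
  simp only [← tensorHom_id]
  exact hV (h.map_le _ _) le_rfl

end ParallelTransports

/-! ### The secondary relations between transports into `Y ^ T`. -/

section SecondaryRelations

variable {V : Type u} [Category.{v} V] [MonoidalCategory V] [OrderedMonoidal V]
  [HasProducts.{t} V] {X : VGraph.{w} V} {X' : VGraph.{w''} V} {Y : VGraph.{w'} V}
  {Z : VGraph.{w''} V} {T : VGraph.{t} V}

theorem Transport.SecLE.trans {g g' g'' : Transport X (Y.exp T)} (h₁ : g.SecLE g')
    (h₂ : g'.SecLE g'') : g.SecLE g'' := by
  obtain ⟨h, ho, hm⟩ := h₁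
  obtain ⟨k, ko, km⟩ := h₂
  refine ⟨fun a s => (h a s).trans (k a s), fun a => (ho a).trans (ko a), fun a b s => ?_⟩
  refine le_trans ?_ (km a b s)
  -- The `eqToHom` from `g` to `g''` is split at `g'`.
  refine le_trans (le_of_eq ?_) (OrderedMonoidal.comp_mono (hm a b s) le_rfl)
  simp

theorem Transport.SecSim.symm {g g' : Transport X (Y.exp T)} (h : g.SecSim g') : g'.SecSim g :=
  ⟨h.2, h.1⟩

theorem Transport.SecSim.trans {g g' g'' : Transport X (Y.exp T)} (h₁ : g.SecSim g')
    (h₂ : g'.SecSim g'') : g.SecSim g'' :=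
  ⟨h₁.1.trans h₂.1, h₂.2.trans h₁.2⟩

theorem Transport.SecLE.precomp {g g' : Transport X (Y.exp T)} (h : g.SecLE g')
    (k : Transport X' X) : (k.comp g).SecLE (k.comp g') := by
  obtain ⟨h, ho, hm⟩ := h
  refine ⟨fun a s => h (k.obj a) s, fun a => ho (k.obj a), fun a b s => ?_⟩
  simp only [Category.assoc] at hm ⊢
  exact OrderedMonoidal.comp_mono le_rfl (hm _ _ s)

theorem Transport.SecLE.exp_comp {g g' : Transport X (Y.exp T)} (h : g.SecLE g')
    (f : Transport Y Z) : (g.comp (f.exp T)).SecLE (g'.comp (f.exp T)) := by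
  obtain ⟨h, ho, hm⟩ := h
  refine ⟨fun a s => congrArg f.obj (h a s), fun a => (ho a).comp (.refl f), fun a b s => ?_⟩
  -- The vertex equalities relate applications such as `(g.obj a).obj s`, which cannot be
  -- substituted. Stated for free vertices of `Y`, the claim allows substitution.
  have e : ∀ {p : V} {x y x' y' : Y.Obj} (hx : x = x') (hy : y = y') (u : p ⟶ Y.Hom x y)
      (u' : p ⟶ Y.Hom x' y') (_ : u ≫ eqToHom (by rw [hx, hy]) ≤ u'),
      (u ≫ f.map x y) ≫ eqToHom (by rw [hx, hy]) ≤ u' ≫ f.map x' y' := by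
    rintro p x y x' y' rfl rfl u u' hu
    simp only [eqToHom_refl, Category.comp_id] at hu ⊢
    exact OrderedMonoidal.comp_mono hu le_rfl
  have := e (h a s) (h b s) _ _ (hm a b s)
  simpa using this

theorem Transport.SecSim.precomp {g g' : Transport X (Y.exp T)} (h : g.SecSim g')
    (k : Transport X' X) : (k.comp g).SecSim (k.comp g') :=
  ⟨h.1.precomp k, h.2.precomp k⟩

theorem Transport.SecSim.exp_comp {g g' : Transport X (Y.exp T)} (h : g.SecSim g')
    (f : Transport Y Z) : (g.comp (f.exp T)).SecSim (g'.comp (f.exp T)) :=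
  ⟨h.1.exp_comp f, h.2.exp_comp f⟩

theorem Transport.LE.exp {f f' : Transport X Y} (h : f.LE f') :
    (f.exp T).SecLE (f'.exp T) := by
  obtain ⟨fo, fm⟩ := f
  obtain ⟨fo', fm'⟩ := f'
  obtain rfl : fo = fo' := h.obj_eq
  refine ⟨fun _ _ => rfl, fun a => (LE.refl a).comp h, fun a b s => ?_⟩
  simp only [lift_component, eqToHom_refl, Category.comp_id]
  exact OrderedMonoidal.comp_mono le_rfl (h.map_le _ _)

/-- The counterpart of `sim_iff_q` for the secondary relation: one family of equations for the
appointed transports, one for the components. -/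
theorem Transport.secSim_iff_q {g g' : Transport X (Y.exp T)} : g.SecSim g' ↔
    ∃ h : ∀ a s, (g.obj a).obj s = (g'.obj a).obj s,
      (∀ a s s', q ((g.obj a).map s s' ≫ eqToHom (by rw [h a s, h a s'])) =
        q ((g'.obj a).map s s')) ∧
      ∀ a b s, q ((g.map a b ≫ component (g.obj a) (g.obj b) s) ≫
        eqToHom (by rw [h a s, h b s])) = q (g'.map a b ≫ component (g'.obj a) (g'.obj b) s) := by
  constructor
  · rintro ⟨⟨h, h₁, h₁'⟩, ⟨_, h₂, h₂'⟩⟩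
    refine ⟨h, fun a => ?_, fun a b s =>
      sim_iff.1 ⟨h₁' a b s, comp_eqToHom_le.1 (h₂' a b s)⟩⟩
    exact (sim_iff_q.1 ⟨h₁ a, h₂ a⟩).2
  · rintro ⟨h, e, e'⟩
    have ho := fun a => sim_iff_q.2 ⟨h a, e a⟩
    exact ⟨⟨h, fun a => (ho a).1, fun a b s => (sim_iff.2 (e' a b s)).1⟩,
      ⟨fun a s => (h a s).symm, fun a => (ho a).2, fun a b s =>
        comp_eqToHom_le.2 (sim_iff.2 (e' a b s)).2⟩⟩

/-- Projections of a product are jointly monic. `HEq` is needed because the hom-objects depend on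
the vertex maps; it becomes an equality once these are identified. -/
theorem Transport.exp_ext {g g' : Transport X (Y.exp T)} (h : ∀ a, g.obj a = g'.obj a)
    (e : ∀ a b s, HEq (g.map a b ≫ component (g.obj a) (g.obj b) s)
      (g'.map a b ≫ component (g'.obj a) (g'.obj b) s)) : g = g' := by
  obtain ⟨go, gm⟩ := g
  obtain ⟨go', gm'⟩ := g'
  obtain rfl : go = go' := funext h
  refine Transport.ext rfl (heq_of_eq ?_)
  funext a b
  exact transforms_ext fun s => eq_of_heq (e a b s)

variable [RelatorInvolution V]

/-- In `Bar V` a hom-arrow of the prerealization is the composite `cc` of a component with a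
hom-arrow of the target transport, and `SecSim` controls both factors. The relation is `∼₂` and not
`≤₂` because `cc` contains `⊗`, which is only assumed to respect `∼`. -/
theorem Transport.SecSim.preReal [∀ s : V, (tensorRight s).IsLeftAdjoint] [ValuesComplete.{t} V]
    {g g' : Transport X (Y.exp T)} (h : g.SecSim g') :
    g.preReal.Sim g'.preReal := by
  obtain ⟨h, ho, hm⟩ := secSim_iff_q.1 h
  refine sim_iff_q.2 ⟨fun a => h a.1 a.2, fun a b => ?_⟩
  -- Again the vertices are made free for substitution: `k` stands for the hom-arrow of the
  -- realization, `u` for the component, `w` for the hom-arrow of the transport.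
  have e : ∀ {p r : V} {x y z x' y' z' : Y.Obj} (hx : x = x') (hy : y = y') (hz : z = z')
      (k : p ⊗ r ⟶ Y.Hom x z) (u : p ⟶ Y.Hom x y) (u' : p ⟶ Y.Hom x' y') (w : r ⟶ Y.Hom y z)
      (w' : r ⟶ Y.Hom y' z') (_ : q k = cc (Y := Y.bar) (q u) (q w))
      (_ : q (u ≫ eqToHom (by rw [hx, hy])) = q u')
      (_ : q (w ≫ eqToHom (by rw [hy, hz])) = q w'),
      q (k ≫ eqToHom (by rw [hx, hz])) = cc (Y := Y.bar) (q u') (q w') := by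
    rintro p r x y z x' y' z' rfl rfl rfl k u u' w w' hk hu hw
    simp only [eqToHom_refl, Category.comp_id] at hu hw ⊢
    rw [hk, hu, hw]
  exact (e (h _ _) (h _ _) (h _ _) _ _ _ _ _ (q_precontact _ _ _) (hm a.1 b.1 a.2)
    (ho b.1 a.2 b.2)).trans (q_precontact _ _ _).symm

theorem Transport.SecSim.postReal [∀ s : V, (tensorRight s).IsLeftAdjoint] [ValuesComplete.{t} V]
    {g g' : Transport X (Y.exp T)} (h : g.SecSim g') :
    g.postReal.Sim g'.postReal := by
  obtain ⟨h, ho, hm⟩ := secSim_iff_q.1 h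
  refine sim_iff_q.2 ⟨fun a => h a.1 a.2, fun a b => ?_⟩
  have e : ∀ {p r : V} {x y z x' y' z' : Y.Obj} (hx : x = x') (hy : y = y') (hz : z = z')
      (k : p ⊗ r ⟶ Y.Hom x z) (u : r ⟶ Y.Hom x y) (u' : r ⟶ Y.Hom x' y') (w : p ⟶ Y.Hom y z)
      (w' : p ⟶ Y.Hom y' z') (_ : q k = (β_ _ _).hom ≫ cc (Y := Y.bar) (q u) (q w))
      (_ : q (u ≫ eqToHom (by rw [hx, hy])) = q u')
      (_ : q (w ≫ eqToHom (by rw [hy, hz])) = q w'),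
      q (k ≫ eqToHom (by rw [hx, hz])) = (β_ _ _).hom ≫ cc (Y := Y.bar) (q u') (q w') := by
    rintro p r x y z x' y' z' rfl rfl rfl k u u' w w' hk hu hw
    simp only [eqToHom_refl, Category.comp_id] at hu hw ⊢
    rw [hk, hu, hw]
  -- In contrast to the prerealization, the first factor is the source transport's hom-arrow and the
  -- second is the component at the endpoint `b.2`.
  exact (e (h _ _) (h _ _) (h _ _) _ _ _ _ _ (q_postcontact _ _ _) (ho a.1 a.2 b.2)
    (hm a.1 b.1 b.2)).trans (q_postcontact _ _ _).symm

/-- On hom-objects naturality of sections is strict and needs no law for `f`: the component inserts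
`1_s` in the `T`-factor, while `f` acts on the other factor. Units of `X` enter only through the
vertex part, treated in the next two theorems. -/
theorem VGraph.sections_component_comp_tensorId (f : Transport X Z) (a b : X.Obj) (s : T.Obj) :
    (((X.sections T).comp ((f.tensorId T).exp T)).map a b ≫ component _ _ s) =
      (f.comp (Z.sections T)).map a b ≫ component _ _ s := by
  simp only [Category.assoc, lift_component]
  rw [← Category.assoc, lift_component, Category.assoc, whisker_exchange]
  simp

theorem Transport.sections_comp_tensorId (f : Transport X Z)
    (hf : ∀ x, X.one x ≫ f.map x x = Z.one (f.obj x)) :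
    (X.sections T).comp ((f.tensorId T).exp T) = f.comp (Z.sections T) := by
  refine exp_ext (fun a => Transport.ext rfl (heq_of_eq ?_)) fun a b s =>
    heq_of_eq (VGraph.sections_component_comp_tensorId f a b s)
  funext s s'
  simp only [Category.assoc, ← comp_whiskerRight, hf]

theorem Transport.IsOriginal.sections_comp_tensorId {f : Transport X Z} (hf : f.IsOriginal) :
    ((X.sections T).comp ((f.tensorId T).exp T)).SecSim (f.comp (Z.sections T)) := by
  refine secSim_iff_q.2 ⟨fun _ _ => rfl, fun a s s' => ?_, fun a b s => ?_⟩
  · simp only [eqToHom_refl, Category.comp_id, Category.assoc, ← comp_whiskerRight]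
    exact sim_iff.1 ((VLax.Sim.refl (λ_ (T.Hom s s')).inv).comp ((hf a).whiskerRight (T.Hom s s')))
  · rw [eqToHom_refl, Category.comp_id]
    exact congrArg q (VGraph.sections_component_comp_tensorId f a b s)

end SecondaryRelations

end VLax

/-! ### Laxly natural functors: compositionality of the constructions and naturality. -/

namespace VLax

/-- Preservation of composition extended to generalized arrows; applied to a component and a
hom-arrow of a functor, it yields naturality of `ev⁺`. -/
theorem LaxFun.cc_map {V : Type u} [Category.{v} V] [MonoidalCategory V] [OrderedMonoidal V]
    [RelatorInvolution V] {X : LaxCat.{w} V} {Y : LaxCat.{w'} V} (f : LaxFun X Y) {A B : V}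
    {x y z : X.Obj} (a : A ⟶ X.Hom x y) (b : B ⟶ X.Hom y z) :
    cc (Y := Y.bar) (q (a ≫ f.map x y)) (q (b ≫ f.map y z)) =
      cc (Y := X.bar) (q a) (q b) ≫ q (f.map x z) := by
  rw [q_comp, q_comp, cc_pre, ← f.q_map_comp]
  simp [cc, VGraph.bar]

theorem LaxFun.tensorId_comp {V : Type u} [Category.{v} V] [MonoidalCategory V] [OrderedMonoidal V]
    [RelatorInvolution V] {X : LaxCat.{w} V} {Y : LaxCat.{w'} V} {Z : LaxCat.{w''} V}
    {T : LaxCat.{t} V} (f : LaxFun X Y) (g : LaxFun Y Z) :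
    (f.comp g).tensorId T = (f.tensorId T).comp (g.tensorId T) :=
  LaxFun.ext rfl <| heq_of_eq <| funext fun _ => funext fun _ => comp_whiskerRight _ _ _

section ClosedStructure

variable {V : Type u} [Category.{v} V] [MonoidalCategory V] [OrderedMonoidal V]
  [∀ s : V, (tensorRight s).IsLeftAdjoint] [HasProducts.{t} V] [ValuesComplete.{t} V]
  [RelatorInvolution V] {X : LaxCat.{w} V} {Y : LaxCat.{w'} V} {Z : LaxCat.{w''} V}
  {T : LaxCat.{t} V}

/-- Strict, because `laxMap` is a lift through `ι` with prescribed components and arrows into a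
product are determined by their components. -/
theorem LaxFun.lexp_comp_incl (f : LaxFun X Y) :
    (f.lexp T).toTransport.comp (Y.incl T) = (X.incl T).comp (f.toTransport.exp T.toVGraph) :=
  Transport.exp_ext (fun _ => rfl) fun φ ψ s => heq_of_eq <| by
    simp only [Category.assoc, lift_component]
    exact (laxMap_component f φ ψ s).trans (Category.assoc _ _ _)

theorem LaxCat.lam_comp_incl (X : LaxCat.{w} V) (T : LaxCat.{t} V) :
    (X.lam T).toTransport.comp ((X.tensor T).incl T) = X.toVGraph.sections T.toVGraph :=
  Transport.exp_ext (fun _ => rfl) fun a b s => heq_of_eq <| by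
    rw [lift_component, Category.assoc]
    exact lamMap_component X T a b s

/-- `LaxFun.SecSim` is defined after composing with `J`. Moving `J` past `f^(T)` transfers such a
comparison to `Y ^ T`, where components are explicit. -/
theorem LaxFun.comp_lexp_comp_incl (g : LaxFun X (Y.lexp T)) (f : LaxFun Y Z) :
    (g.comp (f.lexp T)).toTransport.comp (Z.incl T) =
      (g.toTransport.comp (Y.incl T)).comp (f.toTransport.exp T.toVGraph) := by
  have h := congrArg (fun k => g.toTransport.comp k) (f.lexp_comp_incl (T := T))
  simpa only [Transport.comp, Category.assoc] using h

theorem LaxFun.LE.lexp {f f' : LaxFun X Y} (h : f.LE f') :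
    (f.lexp T).SecLE (f'.lexp T) := by
  rw [LaxFun.SecLE, f.lexp_comp_incl, f'.lexp_comp_incl]
  exact (Transport.LE.exp h).precomp (X.incl T)

theorem LaxFun.Sim.lexp {f f' : LaxFun X Y} (h : f.Sim f') :
    (f.lexp T).SecSim (f'.lexp T) :=
  ⟨LaxFun.LE.lexp h.1, LaxFun.LE.lexp h.2⟩

theorem LaxFun.SecSim.precomp {X' : LaxCat.{w''} V} {g g' : LaxFun X (Y.lexp T)}
    (h : g.SecSim g') (k : LaxFun X' X) : (k.comp g).SecSim (k.comp g') := by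
  simpa only [LaxFun.SecSim, Transport.comp, Category.assoc] using
    Transport.SecSim.precomp h k.toTransport

theorem LaxFun.SecSim.lexp_comp {g g' : LaxFun X (Y.lexp T)}
    (h : g.SecSim g') (f : LaxFun Y Z) : (g.comp (f.lexp T)).SecSim (g'.comp (f.lexp T)) := by
  rw [LaxFun.SecSim, g.comp_lexp_comp_incl, g'.comp_lexp_comp_incl]
  exact Transport.SecSim.exp_comp h f.toTransport

/-- After `J` this is the naturality of the plain sections transport, so the comparison itself uses
only that `f` preserves units. -/
theorem LaxFun.lam_naturality (f : LaxFun X Y) :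
    ((X.lam T).comp ((f.tensorId T).lexp T)).SecSim (f.comp (Y.lam T)) := by
  rw [LaxFun.SecSim, LaxFun.comp_lexp_comp_incl, LaxCat.lam_comp_incl]
  have h : (f.comp (Y.lam T)).toTransport.comp ((Y.tensor T).incl T) =
      f.toTransport.comp (Y.toVGraph.sections T.toVGraph) := by
    rw [← LaxCat.lam_comp_incl]
    simp only [Transport.comp, Category.assoc]
  rw [h]
  exact f.isLaxNatural.map_one.sections_comp_tensorId

/-! ### The two evaluations and the triangular equalities. -/

theorem LaxCat.evPlus_sim_evMinus (Y : LaxCat.{w} V) (T : LaxCat.{t} V) :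
    (Y.evPlus T).Sim (Y.evMinus T) :=
  Transport.Sim.of_map_sim fun a b => evMap_sim a.1 b.1 a.2 b.2

/-- Both sides compose a component with a hom-arrow of the target functor, applying `g` either to
the two factors or to the composite. That `g` preserves composition only up to `∼` is why equality
is not obtained. -/
theorem LaxFun.evPlus_naturality (g : LaxFun X Y) :
    (((g.lexp T).tensorId T).comp (Y.evPlus T)).Sim ((X.evPlus T).comp g) :=
  Transport.Sim.of_map_sim fun a b => sim_iff.2 <| by
    change q (laxMap g a.1 b.1 ▷ _ ≫ evMap _ _ _ _) = q (evMap a.1 b.1 a.2 b.2) ≫ q (g.map _ _)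
    rw [q_comp, q_whiskerRight, q_evMap, q_evMap, ← cc_preL, ← q_comp, laxMap_component]
    exact g.cc_map _ _

theorem LaxFun.evMinus_naturality (g : LaxFun X Y) :
    (((g.lexp T).tensorId T).comp (Y.evMinus T)).Sim ((X.evMinus T).comp g) :=
  ((Transport.Sim.refl _).comp (Y.evPlus_sim_evMinus T).symm).trans
    (g.evPlus_naturality.trans ((X.evPlus_sim_evMinus T).comp (Transport.Sim.refl _)))

/-- The hom-arrow composes `X(a;b) ⊗ 1_s` with `1_b ⊗ T(s;s')`. By interchange (`tensor_pre`) it is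
the tensor product of a right unit law in `X` and a left unit law in `T`. -/
theorem LaxCat.lam_evPlus (X : LaxCat.{w} V) (T : LaxCat.{t} V) :
    (((X.lam T).tensorId T).comp ((X.tensor T).evPlus T)).Sim (LaxFun.id (X.tensor T)) :=
  Transport.Sim.of_map_sim fun a b => sim_iff.2 <| by
    change q (lamMap X T a.1 b.1 ▷ _ ≫ evMap _ _ _ _) = 𝟙 _
    rw [q_comp, q_whiskerRight, q_evMap, ← cc_preL, ← q_comp, lamMap_component]
    have h := tensor_pre (q (T.one a.2)) (q (X.one b.1)) (q (X.comp a.1 b.1 b.1))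
      (q (T.comp a.2 a.2 b.2))
    refine Eq.trans ?_ (h.trans ?_)
    · rw [← q_m]; rfl
    · exact (congrArg₂ (fun f g => f ⊗ₘ g) (X.isLax.bar.comp_one a.1 b.1)
        (T.isLax.bar.one_comp a.2 b.2)).trans (id_tensorHom_id _ _)

theorem LaxCat.lam_evMinus (X : LaxCat.{w} V) (T : LaxCat.{t} V) :
    (((X.lam T).tensorId T).comp ((X.tensor T).evMinus T)).Sim (LaxFun.id (X.tensor T)) :=
  ((Transport.Sim.refl _).comp ((X.tensor T).evPlus_sim_evMinus T).symm).trans (X.lam_evPlus T)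

/-- On vertices the unit transform of `φ` is composed with `φ(T(s;s'))`, so the left unit law of `Y`
returns `φ`. On hom-objects the `s`-component is composed with `ψ(1_s) ∼ 1`, so the right unit law
returns the component. -/
theorem LaxCat.lam_lexp_evPlus (Y : LaxCat.{w} V) (T : LaxCat.{t} V) :
    (((Y.lexp T).lam T).comp ((Y.evPlus T).lexp T)).SecSim (LaxFun.id (Y.lexp T)) := by
  rw [LaxFun.SecSim, LaxFun.comp_lexp_comp_incl, LaxCat.lam_comp_incl]
  refine Transport.secSim_iff_q.2 ⟨fun _ _ => rfl, fun φ s s' => ?_, fun φ ψ s => ?_⟩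
  · rw [eqToHom_refl, Category.comp_id]
    change q (((λ_ _).inv ≫ laxOne φ ▷ _) ≫ evMap φ φ s s') = q (φ.map s s')
    rw [q_comp, q_evMap, q_comp, q_whiskerRight, Category.assoc, ← cc_preL, ← q_comp,
      laxOne_component]
    exact (congrArg (fun k => q (λ_ _).inv ≫ k) (Y.isLax.bar.one_comp' (q (φ.map s s')))).trans
      ((qIso (λ_ _)).inv_hom_id_assoc _)
  · simp only [Category.assoc, lift_component, eqToHom_refl, Category.comp_id]
    rw [← Category.assoc, lift_component]
    change q (((ρ_ _).inv ≫ _ ◁ T.one s) ≫ evMap φ ψ s s) =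
      q (𝟙 _ ≫ laxComponent φ.toTransport ψ.toTransport s)
    rw [q_comp, q_evMap, q_comp, q_whiskerLeft, Category.assoc, ← cc_preR, ψ.q_map_one,
      Category.id_comp]
    exact (congrArg (fun k => q (ρ_ _).inv ≫ k) (Y.isLax.bar.comp_one'
      (q (laxComponent φ.toTransport ψ.toTransport s)))).trans
      ((qIso (ρ_ _)).inv_hom_id_assoc _)

theorem LaxCat.lam_lexp_evMinus (Y : LaxCat.{w} V) (T : LaxCat.{t} V) :
    (((Y.lexp T).lam T).comp ((Y.evMinus T).lexp T)).SecSim (LaxFun.id (Y.lexp T)) :=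
  Transport.SecSim.trans
    (LaxFun.SecSim.precomp (LaxFun.Sim.lexp (Y.evPlus_sim_evMinus T).symm) _)
    (Y.lam_lexp_evPlus T)

/-! ### Names and realizations. -/

theorem LaxFun.name_comp_incl (f : LaxFun (X.tensor T) Y) :
    f.name.toTransport.comp (Y.incl T) = f.toTransport.name := by
  rw [LaxFun.name, LaxFun.comp_lexp_comp_incl, LaxCat.lam_comp_incl, Transport.name]

theorem LaxFun.preReal_toTransport (g : LaxFun X (Y.lexp T)) :
    g.preReal.toTransport = (g.toTransport.comp (Y.incl T)).preReal :=
  Transport.ext rfl <| heq_of_eq <| by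
    funext a b
    simp only [Transport.preReal, Transport.comp, comp_whiskerRight, Category.assoc]

theorem LaxFun.postReal_toTransport (g : LaxFun X (Y.lexp T)) :
    g.postReal.toTransport = (g.toTransport.comp (Y.incl T)).postReal :=
  Transport.ext rfl <| heq_of_eq <| by
    funext a b
    simp only [Transport.postReal, Transport.comp, comp_whiskerRight, Category.assoc]

/-- Factoring through `ι` suffices: the similarity is the defining condition of the inverse image,
whiskered by the hom-arrows of `g`. No law for `g` is involved. -/
theorem Transport.preReal_sim_postReal_of_comp_incl (g : Transport X.toVGraph (Y.lexp T).toVGraph) :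
    (g.comp (Y.incl T)).preReal.Sim (g.comp (Y.incl T)).postReal :=
  Transport.Sim.of_map_sim fun a b => by
    simp only [comp_whiskerRight, Category.assoc]
    exact (VLax.Sim.refl _).comp (evMap_sim _ _ _ _)

/-- Read at the pair `(a, s)`, `(b, s')`, the hypothesis is the similarity of pre- and postcontact
required by `isNat_iff`. The lift through `ι` then recovers the hom-arrow of `g` on the nose,
although the hypothesis is only a similarity. -/
theorem Transport.exists_comp_incl_eq {g : Transport X.toVGraph (Y.toVGraph.exp T.toVGraph)}
    (hg : ∀ a, (g.obj a).IsLaxNatural) (h : g.preReal.Sim g.postReal) :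
    ∃ k : Transport X.toVGraph (Y.lexp T).toVGraph, k.comp (Y.incl T) = g :=
  ⟨⟨fun a => ⟨g.obj a, hg a⟩, fun a b => (laxTransforms (g.obj a) (g.obj b)).lift (g.map a b)
      ((isNat_iff _).2 fun s s' => Transport.Sim.map_sim h (a, s) (b, s'))⟩,
    Transport.ext rfl (heq_of_eq (funext fun _ => funext fun _ => SimInverseImage.lift_ι _ _ _))⟩

/-- Functoriality of `(-)^(T)` for lax categories in three unrelated universes, which `lexpFunctor`
does not cover. -/
theorem LaxFun.lexp_comp (f : LaxFun X Y) (g : LaxFun Y Z) :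
    (f.comp g).lexp T = (f.lexp T).comp (g.lexp T) :=
  lexp_ext (fun φ => (LaxFun.comp_assoc φ f g).symm) fun φ ψ s => by
    refine heq_of_eq ((laxMap_component (f.comp g) φ ψ s).trans (Eq.trans ?_
      (Category.assoc _ _ _).symm))
    refine Eq.trans ?_ (congrArg (fun k => laxMap f φ ψ ≫ k)
      (laxMap_component g (φ.comp f) (ψ.comp f) s)).symm
    exact (reassoc_of% (laxMap_component f φ ψ s)) _ |>.symm

theorem LaxFun.Sim.name {f f' : LaxFun (X.tensor T) Y} (h : f.Sim f') :
    f.name.SecSim f'.name :=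
  LaxFun.SecSim.precomp (LaxFun.Sim.lexp h) _

theorem LaxFun.SecSim.preReal {g g' : LaxFun X (Y.lexp T)} (h : g.SecSim g') :
    g.preReal.Sim g'.preReal := by
  rw [LaxFun.Sim, LaxFun.preReal_toTransport, LaxFun.preReal_toTransport]
  exact Transport.SecSim.preReal h

theorem LaxFun.SecSim.postReal {g g' : LaxFun X (Y.lexp T)} (h : g.SecSim g') :
    g.postReal.Sim g'.postReal := by
  rw [LaxFun.Sim, LaxFun.postReal_toTransport, LaxFun.postReal_toTransport]
  exact Transport.SecSim.postReal h

theorem LaxFun.name_naturality {X' : LaxCat.{w''} V} (k : LaxFun X' X) (f : LaxFun (X.tensor T) Y)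
    (h : LaxFun Y Z) : (((k.tensorId T).comp (f.comp h)).name).SecSim
      (k.comp (f.name.comp (h.lexp T))) := by
  -- Naturality of the unit at `k`, followed by the image of `f` and `h` under `(-)^(T)`; the
  -- rewriting only reassociates and uses `lexp_comp`.
  have e := LaxFun.SecSim.lexp_comp (LaxFun.lam_naturality (T := T) k) (f.comp h)
  rw [LaxFun.comp_assoc, LaxFun.comp_assoc, ← LaxFun.lexp_comp, LaxFun.lexp_comp f h,
    ← LaxFun.comp_assoc (X.lam T)] at e
  exact e

theorem LaxFun.preReal_naturality {X' : LaxCat.{w''} V} (k : LaxFun X' X)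
    (g : LaxFun X (Y.lexp T)) (h : LaxFun Y Z) :
    ((k.comp (g.comp (h.lexp T))).preReal).Sim ((k.tensorId T).comp (g.preReal.comp h)) := by
  have e₁ : (k.comp (g.comp (h.lexp T))).preReal =
      ((k.comp g).tensorId T).comp (((h.lexp T).tensorId T).comp (Z.evPlus T)) := by
    rw [LaxFun.preReal, ← LaxFun.comp_assoc k, LaxFun.tensorId_comp (k.comp g), LaxFun.comp_assoc]
  have e₂ : (k.tensorId T).comp (g.preReal.comp h) =
      ((k.comp g).tensorId T).comp ((Y.evPlus T).comp h) := by
    rw [LaxFun.preReal, LaxFun.comp_assoc (g.tensorId T), ← LaxFun.comp_assoc (k.tensorId T),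
      ← LaxFun.tensorId_comp]
  rw [e₁, e₂]
  exact (Transport.Sim.refl _).comp h.evPlus_naturality

theorem LaxFun.postReal_naturality {X' : LaxCat.{w''} V} (k : LaxFun X' X)
    (g : LaxFun X (Y.lexp T)) (h : LaxFun Y Z) :
    ((k.comp (g.comp (h.lexp T))).postReal).Sim ((k.tensorId T).comp (g.postReal.comp h)) := by
  have e₁ : (k.comp (g.comp (h.lexp T))).postReal =
      ((k.comp g).tensorId T).comp (((h.lexp T).tensorId T).comp (Z.evMinus T)) := by
    rw [LaxFun.postReal, ← LaxFun.comp_assoc k, LaxFun.tensorId_comp (k.comp g), LaxFun.comp_assoc]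
  have e₂ : (k.tensorId T).comp (g.postReal.comp h) =
      ((k.comp g).tensorId T).comp ((Y.evMinus T).comp h) := by
    rw [LaxFun.postReal, LaxFun.comp_assoc (g.tensorId T), ← LaxFun.comp_assoc (k.tensorId T),
      ← LaxFun.tensorId_comp]
  rw [e₁, e₂]
  exact (Transport.Sim.refl _).comp h.evMinus_naturality

/-- Naturality of `ev⁺` moves `f` behind the evaluation at `X ⊗ T`, and the first triangle removes
`λ_X ⊗ T` followed by that evaluation. -/
theorem LaxFun.preReal_name (f : LaxFun (X.tensor T) Y) : f.name.preReal.Sim f := by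
  have e := (f.evPlus_naturality (T := T))
  have e₁ := (Transport.Sim.refl ((X.lam T).tensorId T).toTransport).comp e
  have e₂ := (X.lam_evPlus T).comp (Transport.Sim.refl f.toTransport)
  rw [LaxFun.preReal, LaxFun.tensorId_comp, LaxFun.comp_assoc]
  refine Transport.Sim.trans e₁ ?_
  simpa only [Transport.comp, Category.assoc, Category.id_comp] using e₂

theorem LaxFun.postReal_name (f : LaxFun (X.tensor T) Y) : f.name.postReal.Sim f :=
  ((Transport.Sim.refl _).comp (Y.evPlus_sim_evMinus T).symm).trans f.preReal_name

/-- Dually, naturality of the unit moves `g` in front of the unit at `Y^(T)`, and the second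
triangle finishes. -/
theorem LaxFun.name_preReal (g : LaxFun X (Y.lexp T)) : g.preReal.name.SecSim g := by
  have e₁ := LaxFun.SecSim.lexp_comp (LaxFun.lam_naturality (T := T) g) (Y.evPlus T)
  rw [LaxFun.comp_assoc, LaxFun.comp_assoc, ← LaxFun.lexp_comp] at e₁
  have e₂ := LaxFun.SecSim.precomp (Y.lam_lexp_evPlus T) g
  rw [LaxFun.comp_id] at e₂
  exact Transport.SecSim.trans e₁ e₂

theorem LaxFun.name_postReal (g : LaxFun X (Y.lexp T)) : g.postReal.name.SecSim g :=
  Transport.SecSim.trans (LaxFun.Sim.name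
    ((Transport.Sim.refl _).comp (Y.evPlus_sim_evMinus T).symm)) g.name_preReal

end ClosedStructure

end VLax

end

/-! ### The theorem assembled. -/

theorem mainTheorem9 {V : Type u} [Category.{v} V] [MonoidalCategory V] [OrderedMonoidal V]
    [∀ s : V, (tensorRight s).IsLeftAdjoint] [HasProducts.{t} V] [ValuesComplete.{t} V]
    [RelatorInvolution V] (T : LaxCat.{t} V) :
    -- The superfunctor `- ⊗ T`: biproduct with the identity functor; monotone for a monotone `⊗`.
    (∀ (X Y : LaxCat.{max t v w} V) (g : X ⟶ Y),
      ((tensorFunctor.{w} V T).map g).toTransport = g.toTransport.tensorId T.toVGraph) ∧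
    (MonotoneBiproduct V → ∀ (X Y : LaxCat.{max t v w} V) (g g' : X ⟶ Y),
      LaxFun.LE g g' →
        LaxFun.LE ((tensorFunctor.{w} V T).map g) ((tensorFunctor.{w} V T).map g')) ∧
    -- The superfunctor `(-)^(T)`: restriction of `f ^ T` to laxly natural transforms; monotone.
    (∀ (X Y : LaxCat.{max t v w} V) (f : X ⟶ Y),
      ((lexpFunctor.{w} V T).map f).toTransport.comp (Y.incl T) =
        (X.incl T).comp (f.toTransport.exp T.toVGraph)) ∧
    (∀ (X Y : LaxCat.{max t v w} V) (f f' : X ⟶ Y), LaxFun.LE f f' →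
      LaxFun.SecLE (T := T) ((lexpFunctor.{w} V T).map f) ((lexpFunctor.{w} V T).map f')) ∧
    -- The unit: sections functors, natural for arbitrary transports of original `V`-graphs.
    (∀ X : LaxCat.{max t v w} V,
      (X.lam T).toTransport.comp ((X.tensor T).incl T) = X.toVGraph.sections T.toVGraph) ∧
    (∀ (X Y : VGraph.{max t v w} V) (f : Transport X Y), f.IsOriginal →
      ((X.sections T.toVGraph).comp ((f.tensorId T.toVGraph).exp T.toVGraph)).SecSim
        (f.comp (Y.sections T.toVGraph))) ∧
    (∀ (X Y : VGraph.{max t v w} V) (f : Transport X Y),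
      (∀ x, X.one x ≫ f.map x x = Y.one (f.obj x)) →
      (X.sections T.toVGraph).comp ((f.tensorId T.toVGraph).exp T.toVGraph) =
        f.comp (Y.sections T.toVGraph)) ∧
    (∀ (X Y : LaxCat.{max t v w} V) (f : X ⟶ Y),
      LaxFun.SecSim (T := T)
        (X.lam T ≫ (lexpFunctor.{w} V T).map ((tensorFunctor.{w} V T).map f)) (f ≫ Y.lam T)) ∧
    -- The two counits: evaluation functors, equal up to canonical isomorphism and natural.
    (∀ Y : LaxCat.{max t v w} V,
      (Y.evPlus T).toTransport =
        ((Y.incl T).tensorId T.toVGraph).comp (Y.toVGraph.preEval T.toVGraph) ∧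
      (Y.evMinus T).toTransport =
        ((Y.incl T).tensorId T.toVGraph).comp (Y.toVGraph.postEval T.toVGraph) ∧
      LaxFun.Sim (Y.evPlus T) (Y.evMinus T)) ∧
    (∀ (Y Y' : LaxCat.{max t v w} V) (g : Y ⟶ Y'),
      LaxFun.Sim
        ((tensorFunctor.{w} V T).map ((lexpFunctor.{w} V T).map g) ≫ Y'.evPlus T)
        (Y.evPlus T ≫ g) ∧
      LaxFun.Sim
        ((tensorFunctor.{w} V T).map ((lexpFunctor.{w} V T).map g) ≫ Y'.evMinus T)
        (Y.evMinus T ≫ g)) ∧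
    -- The triangular equalities, for both counits.
    (∀ X : LaxCat.{max t v w} V,
      LaxFun.Sim ((tensorFunctor.{w} V T).map (X.lam T) ≫ (X.tensor T).evPlus T)
        (𝟙 (X.tensor T)) ∧
      LaxFun.Sim ((tensorFunctor.{w} V T).map (X.lam T) ≫ (X.tensor T).evMinus T)
        (𝟙 (X.tensor T))) ∧
    (∀ Y : LaxCat.{max t v w} V,
      LaxFun.SecSim ((Y.lexp T).lam T ≫ (lexpFunctor.{w} V T).map (Y.evPlus T))
        (𝟙 (Y.lexp T)) ∧
      LaxFun.SecSim ((Y.lexp T).lam T ≫ (lexpFunctor.{w} V T).map (Y.evMinus T))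
        (𝟙 (Y.lexp T))) ∧
    -- Names and realizations: mutually inverse up to canonical isomorphism, and natural.
    (∀ (X Y : LaxCat.{max t v w} V) (f : X.tensor T ⟶ Y),
      (LaxFun.name f).toTransport.comp (Y.incl T) = f.toTransport.name ∧
      LaxFun.Sim (LaxFun.preReal (LaxFun.name f)) f ∧
      LaxFun.Sim (LaxFun.postReal (LaxFun.name f)) f) ∧
    (∀ (X Y : LaxCat.{max t v w} V) (g : X ⟶ Y.lexp T),
      (LaxFun.preReal g).toTransport = (g.toTransport.comp (Y.incl T)).preReal ∧
      (LaxFun.postReal g).toTransport = (g.toTransport.comp (Y.incl T)).postReal ∧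
      LaxFun.SecSim (LaxFun.name (LaxFun.preReal g)) g ∧
      LaxFun.SecSim (LaxFun.name (LaxFun.postReal g)) g) ∧
    (∀ (X Y : LaxCat.{max t v w} V) (f f' : X.tensor T ⟶ Y),
      LaxFun.Sim f f' ↔ LaxFun.SecSim (LaxFun.name f) (LaxFun.name f')) ∧
    (∀ (X Y : LaxCat.{max t v w} V) (g g' : X ⟶ Y.lexp T),
      (LaxFun.SecSim g g' ↔
        LaxFun.Sim (LaxFun.preReal g) (LaxFun.preReal g')) ∧
      (LaxFun.SecSim g g' ↔
        LaxFun.Sim (LaxFun.postReal g) (LaxFun.postReal g'))) ∧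
    (∀ (X X' Y Y' : LaxCat.{max t v w} V) (k : X' ⟶ X) (f : X.tensor T ⟶ Y) (h : Y ⟶ Y'),
      LaxFun.SecSim (LaxFun.name ((tensorFunctor.{w} V T).map k ≫ f ≫ h))
        (k ≫ LaxFun.name f ≫ (lexpFunctor.{w} V T).map h)) ∧
    (∀ (X X' Y Y' : LaxCat.{max t v w} V) (k : X' ⟶ X) (g : X ⟶ Y.lexp T) (h : Y ⟶ Y'),
      LaxFun.Sim
        (LaxFun.preReal (k ≫ g ≫ (lexpFunctor.{w} V T).map h))
        ((tensorFunctor.{w} V T).map k ≫ LaxFun.preReal g ≫ h) ∧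
      LaxFun.Sim
        (LaxFun.postReal (k ≫ g ≫ (lexpFunctor.{w} V T).map h))
        ((tensorFunctor.{w} V T).map k ≫ LaxFun.postReal g ≫ h)) ∧
    -- The name of a form lands in the laxly natural transforms between laxly natural functors
    -- exactly when `f⁺ ∼ f ∼ f⁻`: for laxly natural forms, and for all transports `f` with laxly
    -- natural sections, an upper predecomposition `f ≤ f⁺` and a lower postdecomposition `f⁻ ≤ f`
    -- (without the last two conditions: exactly when `f⁺ ∼ f⁻`).
    (∀ (X Y : LaxCat.{max t v w} V) (f : X.tensor T ⟶ Y),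
      (∃ g : X ⟶ Y.lexp T, g.toTransport.comp (Y.incl T) = f.toTransport.name) ↔
        f.toTransport.name.preReal.Sim f.toTransport ∧
          f.toTransport.Sim f.toTransport.name.postReal) ∧
    (∀ (X Y : LaxCat.{max t v w} V)
      (f : Transport (X.toVGraph.tensor T.toVGraph) Y.toVGraph),
      (∀ a, (f.name.obj a).IsLaxNatural) →
      ((∃ g : Transport X.toVGraph (Y.lexp T).toVGraph, g.comp (Y.incl T) = f.name) ↔
        f.name.preReal.Sim f.name.postReal) ∧
      (f.LE f.name.preReal → f.name.postReal.LE f →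
        ((∃ g : Transport X.toVGraph (Y.lexp T).toVGraph, g.comp (Y.incl T) = f.name) ↔
          f.name.preReal.Sim f ∧ f.Sim f.name.postReal))) := by
  -- The general criterion, isolated because both assertions about arbitrary transports `f` rest on
  -- it.
  have lift_name_iff : ∀ (X Y : LaxCat.{max t v w} V)
      (f : Transport (X.toVGraph.tensor T.toVGraph) Y.toVGraph),
      (∀ a, (f.name.obj a).IsLaxNatural) →
      ((∃ g : Transport X.toVGraph (Y.lexp T).toVGraph, g.comp (Y.incl T) = f.name) ↔
        f.name.preReal.Sim f.name.postReal) := fun X Y f hf =>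
    ⟨fun ⟨g, hg⟩ => hg ▸ g.preReal_sim_postReal_of_comp_incl, Transport.exists_comp_incl_eq hf⟩
  refine ⟨fun X Y g => rfl, fun hV X Y g g' h => Transport.LE.tensorId hV h _,
    fun X Y f => LaxFun.lexp_comp_incl f, fun X Y f f' h => LaxFun.LE.lexp h,
    fun X => X.lam_comp_incl T, fun X Y f hf => hf.sections_comp_tensorId,
    fun X Y f hf => f.sections_comp_tensorId hf, fun X Y f => LaxFun.lam_naturality f,
    fun Y => ⟨rfl, rfl, Y.evPlus_sim_evMinus T⟩,
    fun Y Y' g => ⟨LaxFun.evPlus_naturality g, LaxFun.evMinus_naturality g⟩,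
    fun X => ⟨X.lam_evPlus T, X.lam_evMinus T⟩,
    fun Y => ⟨Y.lam_lexp_evPlus T, Y.lam_lexp_evMinus T⟩,
    fun X Y f => ⟨LaxFun.name_comp_incl f, LaxFun.preReal_name f, LaxFun.postReal_name f⟩,
    fun X Y g => ⟨LaxFun.preReal_toTransport g, LaxFun.postReal_toTransport g,
      LaxFun.name_preReal g, LaxFun.name_postReal g⟩,
    fun X Y f f' => ⟨LaxFun.Sim.name, fun h => ?_⟩,
    fun X Y g g' => ⟨⟨LaxFun.SecSim.preReal, fun h => ?_⟩, ⟨LaxFun.SecSim.postReal, fun h => ?_⟩⟩,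
    fun X X' Y Y' k f h => LaxFun.name_naturality k f h,
    fun X X' Y Y' k g h => ⟨LaxFun.preReal_naturality k g h, LaxFun.postReal_naturality k g h⟩,
    fun X Y f => ?_,
    fun X Y f hf => ⟨lift_name_iff X Y f hf, fun h₁ h₂ => (lift_name_iff X Y f hf).trans ?_⟩⟩
  -- Reflection is formal in this and the next two goals: the inverse operation preserves similarity
  -- and returns the original arrows up to similarity.
  · exact (LaxFun.preReal_name f).symm.trans
      ((LaxFun.SecSim.preReal h).trans (LaxFun.preReal_name f'))
  · exact (LaxFun.name_preReal g).symm.trans ((LaxFun.Sim.name h).trans (LaxFun.name_preReal g'))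
  · exact (LaxFun.name_postReal g).symm.trans ((LaxFun.Sim.name h).trans (LaxFun.name_postReal g'))
  -- For a laxly natural `f` both sides of the equivalence hold outright, so neither implication
  -- uses its premise.
  · refine ⟨fun _ => ⟨?_, ?_⟩, fun _ => ⟨LaxFun.name f, LaxFun.name_comp_incl f⟩⟩
    · rw [← LaxFun.name_comp_incl, ← LaxFun.preReal_toTransport]
      exact LaxFun.preReal_name f
    · rw [← LaxFun.name_comp_incl, ← LaxFun.postReal_toTransport]
      exact (LaxFun.postReal_name f).symm
  -- The cycle `f ≤ f⁺ ≤ f⁻ ≤ f` makes all three similar.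
  · exact ⟨fun h => ⟨⟨h.1.trans h₂, h₁⟩, ⟨h₁.trans h.1, h₂⟩⟩, fun h => h.1.trans h.2⟩
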